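/- Let $m\ge 1$, $\vec h\in\mathbb R^m$, and let $\vec\beta_p\in\mathbb R^m$ ($p\ge 2$) satisfy $\vec\beta_p=0$ for odd $p$ and $\sum_{p\ge2}2^p\vec\beta_p(j)^2<\infty$ for all $1\le j\le m$ (the inverse temperature is absorbed into $\vec\beta_p$ and $\vec h$). For an $m\times m$ matrix $A$ with entries in $[-1,1]$ put $\xi'(A)=\sum_{p\ge 2}p\,(\vec\beta_p\vec\beta_p^T)\odot A^{\circ(p-1)}$, where $\odot$ and $A^{\circ k}$ denote the entrywise product and power. Let $Q$ be a positive semidefinite $m\times m$ matrix with entries in $[-1,1]$ and unit diagonal. Let $\mathcal A$ be the set of pairs $(x,\Phi)$ such that $x:[0,m]\to[0,1]$ is nondecreasing and right-continuous with $x(m)=1$; $\Phi$ is a $1$-Lipschitz path of positive semidefinite $m\times m$ matrices on $[0,m]$, nondecreasing in the semidefinite order, with $\mathrm{Trace}\,\Phi(t)=t$, $\Phi(0)=0$, $\Phi(m)=Q$; and $t_x:=\inf\{t\in[0,m]:x(t)=1\}$ satisfies $t_x<m$ and $\det(Q-\Phi(t_x))>0$. For $(x,\Phi)\in\mathcal A$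 set $\hat\Phi(t)=\int_t^m x(s)\Phi'(s)\,ds$ and $$\mathscr C(x,\Phi)=\frac12\Big[\int_0^m x(t)\big\langle \xi'(\Phi(t))+\vec h\vec h^T,\Phi'(t)\big\rangle dt+\log\det(\Phi(m)-\Phi(\hat T))+\int_0^{\hat T}\big\langle\hat\Phi(t)^{-1},\Phi'(t)\big\rangle dt\Big],$$ where $\langle\cdot,\cdot\rangle$ is the Frobenius inner product and $\hat T\in(t_x,m)$ is any point with $\det(Q-\Phi(\hat T))>0$ (the value does not depend on $\hat T$). Let $(x,\Phi)\in\mathcal A$ attain the infimum of the Crisanti–Sommers functional, in the sense that $\mathscr C(x,\Phi)\le\mathscr C(y,\Psi)$ for all $(y,\Psi)\in\mathcal A$ with $y(0)=0$ (this includes every minimizer of $\mathscr C$ over $\{(y,\Psi)\in\mathcal A: y(0)=0\}$ and every minimizer over $\mathcal A$), and let $\mu$ be the Parisi measure, i.e. the probability measure on $[0,m]$ with $\mu([0,t])=x(t)$ for all $t\in[0,m]$. Then for every $t\in\operatorname{supp}\mu$ the matrices $\hat\Phi(s)$, $0\le s\le t$, are invertible, the integral below converges absolutely, and $$\xi'(\Phi(t))+\vec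 h\vec h^T=\int_0^t\hat\Phi(s)^{-1}\Phi'(s)\hat\Phi(s)^{-1}\,ds .$$ -/

import Mathlib

open MeasureTheory

noncomputable section

namespace VectorSpin

variable {m : ℕ}

/-- The Frobenius inner product of two matrices. -/
def frob (A B : Matrix (Fin m) (Fin m) ℝ) : ℝ := ∑ i, ∑ j, A i j * B i j

/-- The matrix `ξ'(A) = ∑_{p ≥ 2} p (β_p ⊗ β_p) ⊙ A^{∘(p-1)}` (the summation index is `p + 2`). -/
def xiPrime (β : ℕ → Fin m → ℝ) (A : Matrix (Fin m) (Fin m) ℝ) : Matrix (Fin m) (Fin m) ℝ :=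
  Matrix.of fun i j => ∑' p : ℕ, ((p : ℝ) + 2) * (β (p + 2) i * β (p + 2) j) * A i j ^ (p + 1)

/-- The self-overlap constraints: positive semidefinite matrices with entries in `[-1, 1]` and
unit diagonal. -/
structure IsOverlapConstraint (Q : Matrix (Fin m) (Fin m) ℝ) : Prop where
  posSemidef : Q.PosSemidef
  entries : ∀ i j, Q i j ∈ Set.Icc (-1 : ℝ) 1
  diag : ∀ i, Q i i = 1

/-- Distribution functions on `[0, m]`: nondecreasing right-continuous `x : [0, m] → [0, 1]` with
`x m = 1`. The value `x 0` is the mass at `0`; the requirement `x 0 = 0` is imposed separately.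
Only the restriction of `x` to `[0, m]` matters. -/
structure IsDistributionPath (m : ℕ) (x : ℝ → ℝ) : Prop where
  mem : ∀ t ∈ Set.Icc (0 : ℝ) m, x t ∈ Set.Icc (0 : ℝ) 1
  mono : MonotoneOn x (Set.Icc (0 : ℝ) m)
  rightCont : ∀ t ∈ Set.Ico (0 : ℝ) m, ContinuousWithinAt x (Set.Ici t) t
  right_end : x m = 1

/-- `1`-Lipschitz (for the Frobenius norm) monotone paths of positive semidefinite matrices on
`[0, m]` from `0` to `Q`, parametrized by their trace. Only the restriction to `[0, m]` matters. -/
structure IsMatrixPath (Q : Matrix (Fin m) (Fin m) ℝ) (Φ : ℝ → Matrix (Fin m) (Fin m) ℝ) :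
    Prop where
  posSemidef : ∀ t ∈ Set.Icc (0 : ℝ) m, (Φ t).PosSemidef
  mono : ∀ s ∈ Set.Icc (0 : ℝ) m, ∀ t ∈ Set.Icc (0 : ℝ) m, s ≤ t → (Φ t - Φ s).PosSemidef
  lipschitz : ∀ s ∈ Set.Icc (0 : ℝ) m, ∀ t ∈ Set.Icc (0 : ℝ) m,
    √(frob (Φ t - Φ s) (Φ t - Φ s)) ≤ |t - s|
  trace_eq : ∀ t ∈ Set.Icc (0 : ℝ) m, (Φ t).trace = t
  left_end : Φ 0 = 0
  right_end : Φ m = Q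

/-- `t_x = inf {t ∈ [0, m] | x t = 1}`. -/
def topTime (m : ℕ) (x : ℝ → ℝ) : ℝ := sInf {t | t ∈ Set.Icc (0 : ℝ) m ∧ x t = 1}

/-- The entrywise derivative `Φ'(t)`, which exists for almost every `t` when `Φ` is Lipschitz. -/
def pathDeriv (Φ : ℝ → Matrix (Fin m) (Fin m) ℝ) (t : ℝ) : Matrix (Fin m) (Fin m) ℝ :=
  Matrix.of fun i j => deriv (fun s => Φ s i j) t

/-- `Φ̂(t) = ∫_t^m x(s) Φ'(s) ds`. -/
def pathHat (x : ℝ → ℝ) (Φ : ℝ → Matrix (Fin m) (Fin m) ℝ) (t : ℝ) :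
    Matrix (Fin m) (Fin m) ℝ :=
  Matrix.of fun i j => ∫ s in t..(m : ℝ), x s * pathDeriv Φ s i j

/-- The pairs `(x, Φ)` on which the Crisanti–Sommers functional is defined, except that `x 0` is
not required to vanish. -/
structure IsAdmissible (Q : Matrix (Fin m) (Fin m) ℝ) (x : ℝ → ℝ)
    (Φ : ℝ → Matrix (Fin m) (Fin m) ℝ) : Prop where
  distr : IsDistributionPath m x
  path : IsMatrixPath Q Φ
  topTime_lt : topTime m x < m
  det_pos : 0 < (Q - Φ (topTime m x)).det

/-- The truncation points `T ∈ (t_x, m)` at which `log |Q - Φ(T)|` makes sense. -/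
def IsCutoff (Q : Matrix (Fin m) (Fin m) ℝ) (x : ℝ → ℝ) (Φ : ℝ → Matrix (Fin m) (Fin m) ℝ)
    (T : ℝ) : Prop :=
  topTime m x < T ∧ T < m ∧ 0 < (Q - Φ T).det

/-- The Crisanti–Sommers functional, written with the truncation point `T`; its value does not
depend on the choice of `T` with `IsCutoff Q x Φ T`. -/
def crisantiSommers (β : ℕ → Fin m → ℝ) (h : Fin m → ℝ) (x : ℝ → ℝ)
    (Φ : ℝ → Matrix (Fin m) (Fin m) ℝ) (T : ℝ) : ℝ :=
  (1 / 2) *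
    ((∫ t in (0 : ℝ)..m,
        x t * frob (xiPrime β (Φ t) + Matrix.vecMulVec h h) (pathDeriv Φ t))
      + Real.log (Φ m - Φ T).det
      + ∫ t in (0 : ℝ)..T, frob (pathHat x Φ t)⁻¹ (pathDeriv Φ t))

/-- `(x, Φ)` attains the infimum of the Crisanti–Sommers functional over the admissible pairs
`(y, Ψ)` with `y 0 = 0`. The minimizing distribution itself may have an atom at `0`. This covers
the minimizers among the pairs with `x 0 = 0` as well as those among all admissible pairs. -/
def IsMinimizer (β : ℕ → Fin m → ℝ) (h : Fin m → ℝ) (Q : Matrix (Fin m) (Fin m) ℝ)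
    (x : ℝ → ℝ) (Φ : ℝ → Matrix (Fin m) (Fin m) ℝ) : Prop :=
  IsAdmissible Q x Φ ∧
    ∀ (y : ℝ → ℝ) (Ψ : ℝ → Matrix (Fin m) (Fin m) ℝ), IsAdmissible Q y Ψ → y 0 = 0 →
      ∀ T S : ℝ, IsCutoff Q x Φ T → IsCutoff Q y Ψ S →
        crisantiSommers β h x Φ T ≤ crisantiSommers β h y Ψ S

/-- `μ` is the measure on `[0, m]` with distribution function `x`: `μ([0, t]) = x(t)`. -/
def IsParisiMeasure (m : ℕ) (x : ℝ → ℝ) (μ : Measure ℝ) : Prop :=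
  μ (Set.Icc (0 : ℝ) m)ᶜ = 0 ∧
    ∀ t ∈ Set.Icc (0 : ℝ) m, μ (Set.Icc 0 t) = ENNReal.ofReal (x t)

end VectorSpin

end

open MeasureTheory Set Filter Topology
open scoped Matrix.Norms.L2Operator NNReal

/-!
The functional is differentiated along two kinds of perturbation of the minimizing path.

Fix a cutoff `τ`. For a `C¹` positive nondecreasing `φ`, a positive semidefinite `P` of positive
trace and small `ε > 0`, the curve `Φ + ε (φ P - a Φ)` is nondecreasing and strictly below `Q` on
`[0, τ]`. Reparametrized by its trace, and with `x` transported along, it is a competitor with no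
mass at `0`: its initial jump `ε φ(0) P` becomes a segment without mass. The functional does not
depend on the parametrization, and integration by parts turns twice its derivative at `ε = 0` into
`-∫ ⟨F, φ P - a Φ⟩ dμ`, where `F` is the difference of the two sides of the stationarity equation.

Put `S(q) = ∫_{[q, τ]} F dμ`. Letting `φ` tend to the indicator of `[q, ∞)` yields `S(q) ≤ 0`, and
`φ P - a Φ = δ I - Φ` with `δ → 0` yields `∫ ⟨F, Φ⟩ dμ ≥ 0`. Since
`∫ ⟨F, Φ⟩ dμ = ∫ ⟨S, Φ'⟩ dq` and `⟨S, Φ'⟩ ≤ 0`, it follows that `S Φ' = 0` almost everywhere.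

Finally test `F` against `Φ̂ F Φ̂`. In the derivative of `Φ̂ F Φ̂` every term with a factor `Φ'` on
the left or on the right is orthogonal to `S`, and what remains is `Φ̂ (ξ'(Φ))' Φ̂ ≥ 0` by the
Schur product theorem. With `F(0) = h hᵀ ≥ 0` this gives
`∫ tr (F Φ̂ F Φ̂) dμ = ⟨S(0), (Φ̂ F Φ̂)(0)⟩ + ∫ ⟨S, (Φ̂ F Φ̂)'⟩ dq ≤ 0`,
whereas the integrand is nonnegative and vanishes only where `F = 0`.
-/

noncomputable section

namespace VectorSpin

section LipschitzPrimitive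

variable {E F G : Type*} [NormedAddCommGroup E] [NormedSpace ℝ E] [NormedAddCommGroup F]
  [NormedSpace ℝ F] [NormedAddCommGroup G] [NormedSpace ℝ G]

/-- `f` is Lipschitz on `[a, b]` with derivative `f'` at almost every point. Matrix paths and the
functions built from them have exactly this regularity, which suffices for integration by parts. -/
structure IsLipschitzPrimitiveOn (f f' : ℝ → E) (a b : ℝ) : Prop where
  lipschitz : ∃ K, LipschitzOnWith K f (Icc a b)
  deriv : ∀ᵐ t, t ∈ Ioo a b → HasDerivAt f (f' t) t

namespace IsLipschitzPrimitiveOn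

variable {f f' g' : ℝ → E} {g : ℝ → E} {a b c d : ℝ}

lemma mono (hf : IsLipschitzPrimitiveOn f f' a b) (hc : a ≤ c) (hd : d ≤ b) :
    IsLipschitzPrimitiveOn f f' c d := by
  obtain ⟨K, hK⟩ := hf.lipschitz
  refine ⟨⟨K, hK.mono (Icc_subset_Icc hc hd)⟩, ?_⟩
  filter_upwards [hf.deriv] with t ht hmem using ht (Ioo_subset_Ioo hc hd hmem)

lemma continuousOn (hf : IsLipschitzPrimitiveOn f f' a b) : ContinuousOn f (Icc a b) :=
  hf.lipschitz.choose_spec.continuousOn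

lemma exists_norm_deriv_le (hf : IsLipschitzPrimitiveOn f f' a b) :
    ∃ C : ℝ≥0, ∀ᵐ t, t ∈ Ioo a b → ‖f' t‖ ≤ C := by
  obtain ⟨K, hK⟩ := hf.lipschitz
  refine ⟨K, ?_⟩
  filter_upwards [hf.deriv] with t ht hmem
  exact (ht hmem).le_of_lipschitzOn (Icc_mem_nhds hmem.1 hmem.2) hK

lemma congr_deriv (hf : IsLipschitzPrimitiveOn f f' a b)
    (h : ∀ᵐ t, t ∈ Ioo a b → f' t = g' t) : IsLipschitzPrimitiveOn f g' a b := by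
  refine ⟨hf.lipschitz, ?_⟩
  filter_upwards [hf.deriv, h] with t hft hgt hmem using hgt hmem ▸ hft hmem

lemma congr (hf : IsLipschitzPrimitiveOn f f' a b) (h : EqOn f g (Icc a b)) :
    IsLipschitzPrimitiveOn g f' a b := by
  obtain ⟨K, hK⟩ := hf.lipschitz
  refine ⟨⟨K, fun s hs t ht => ?_⟩, ?_⟩
  · rw [← h hs, ← h ht]
    exact hK hs ht
  filter_upwards [hf.deriv] with t ht hmem
  exact (ht hmem).congr_of_eventuallyEq
    (h.symm.eventuallyEq_of_mem (Icc_mem_nhds hmem.1 hmem.2))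

lemma const (e : E) (a b : ℝ) : IsLipschitzPrimitiveOn (fun _ => e) (fun _ => 0) a b :=
  ⟨⟨0, (LipschitzWith.const e).lipschitzOnWith⟩, ae_of_all _ fun t _ => hasDerivAt_const t e⟩

lemma add (hf : IsLipschitzPrimitiveOn f f' a b) (hg : IsLipschitzPrimitiveOn g g' a b) :
    IsLipschitzPrimitiveOn (fun t => f t + g t) (fun t => f' t + g' t) a b := by
  obtain ⟨K, hK⟩ := hf.lipschitz
  obtain ⟨L, hL⟩ := hg.lipschitz
  refine ⟨⟨K + L, hK.add hL⟩, ?_⟩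
  filter_upwards [hf.deriv, hg.deriv] with t hft hgt hmem using (hft hmem).add (hgt hmem)

lemma clm_comp (T : E →L[ℝ] F) (hf : IsLipschitzPrimitiveOn f f' a b) :
    IsLipschitzPrimitiveOn (fun t => T (f t)) (fun t => T (f' t)) a b := by
  obtain ⟨K, hK⟩ := hf.lipschitz
  refine ⟨⟨_, T.lipschitz.comp_lipschitzOnWith hK⟩, ?_⟩
  filter_upwards [hf.deriv] with t ht hmem using T.hasFDerivAt.comp_hasDerivAt t (ht hmem)

lemma const_smul (r : ℝ) (hf : IsLipschitzPrimitiveOn f f' a b) :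
    IsLipschitzPrimitiveOn (fun t => r • f t) (fun t => r • f' t) a b :=
  hf.clm_comp (r • ContinuousLinearMap.id ℝ E)

lemma neg (hf : IsLipschitzPrimitiveOn f f' a b) :
    IsLipschitzPrimitiveOn (fun t => -f t) (fun t => -f' t) a b := by
  simpa only [neg_smul, one_smul] using hf.const_smul (-1)

lemma sub (hf : IsLipschitzPrimitiveOn f f' a b) (hg : IsLipschitzPrimitiveOn g g' a b) :
    IsLipschitzPrimitiveOn (fun t => f t - g t) (fun t => f' t - g' t) a b := by
  simpa only [sub_eq_add_neg] using hf.add hg.neg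

lemma prodMk {k k' : ℝ → F} (hf : IsLipschitzPrimitiveOn f f' a b)
    (hk : IsLipschitzPrimitiveOn k k' a b) :
    IsLipschitzPrimitiveOn (fun t => (f t, k t)) (fun t => (f' t, k' t)) a b := by
  obtain ⟨K, hK⟩ := hf.lipschitz
  obtain ⟨L, hL⟩ := hk.lipschitz
  refine ⟨⟨max K L, hK.prodMk hL⟩, ?_⟩
  filter_upwards [hf.deriv, hk.deriv] with t hft hkt hmem using (hft hmem).prodMk (hkt hmem)

lemma contDiffAt_comp {k : E → F} (hk : ∀ t ∈ Icc a b, ContDiffAt ℝ 1 k (f t))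
    (hf : IsLipschitzPrimitiveOn f f' a b) :
    IsLipschitzPrimitiveOn (fun t => k (f t)) (fun t => fderiv ℝ k (f t) (f' t)) a b := by
  obtain ⟨K, hK⟩ := hf.lipschitz
  refine ⟨LocallyLipschitzOn.exists_lipschitzOnWith_of_compact isCompact_Icc fun t ht => ?_, ?_⟩
  · obtain ⟨L, U, hU, hL⟩ := (hk t ht).exists_lipschitzOnWith
    refine ⟨L * K, f ⁻¹' U ∩ Icc a b, inter_mem (hf.continuousOn t ht hU) self_mem_nhdsWithin, ?_⟩
    exact hL.comp (hK.mono inter_subset_right) fun s hs => hs.1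
  · filter_upwards [hf.deriv] with t ht hmem
    have hkt := (hk t (Ioo_subset_Icc_self hmem)).differentiableAt one_ne_zero
    exact hkt.hasFDerivAt.comp_hasDerivAt t (ht hmem)

lemma bilinear (B : E →L[ℝ] F →L[ℝ] G) {k k' : ℝ → F} (hf : IsLipschitzPrimitiveOn f f' a b)
    (hk : IsLipschitzPrimitiveOn k k' a b) :
    IsLipschitzPrimitiveOn (fun t => B (f t) (k t)) (fun t => B (f t) (k' t) + B (f' t) (k t))
      a b := by
  refine ((hf.prodMk hk).contDiffAt_comp (k := fun z => B z.1 z.2)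
    fun t _ => B.isBoundedBilinearMap.contDiff.contDiffAt).congr_deriv (ae_of_all _ fun t _ => ?_)
  rw [B.isBoundedBilinearMap.fderiv]
  rfl

section Complete

variable [CompleteSpace E]

lemma intervalIntegrable (hf : IsLipschitzPrimitiveOn f f' a b) (hab : a ≤ b) :
    IntervalIntegrable f' volume a b := by
  obtain ⟨C, hC⟩ := hf.exists_norm_deriv_le
  have hmeas : AEStronglyMeasurable f' (volume.restrict (Ioo a b)) := by
    refine (stronglyMeasurable_deriv f).aestronglyMeasurable.congr
      ((ae_restrict_iff' measurableSet_Ioo).2 ?_)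
    filter_upwards [hf.deriv] with t ht hmem using (ht hmem).deriv
  exact (intervalIntegrable_iff_integrableOn_Ioo_of_le hab).2
    ⟨hmeas, HasFiniteIntegral.restrict_of_bounded C (by simp)
      ((ae_restrict_iff' measurableSet_Ioo).2 hC)⟩

lemma of_integral {C : ℝ} (hf : IntervalIntegrable f' volume a b)
    (hC : ∀ᵐ t, t ∈ Ioo a b → ‖f' t‖ ≤ C) (hc : c ∈ Icc a b) :
    IsLipschitzPrimitiveOn (fun t => ∫ s in c..t, f' s) f' a b := by
  have hab : a ≤ b := hc.1.trans hc.2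
  refine ⟨⟨C.toNNReal, LipschitzOnWith.of_dist_le_mul fun s hs t ht => ?_⟩, ?_⟩
  · have hint : ∀ s ∈ Icc a b, IntervalIntegrable f' volume c s := fun s hs =>
      hf.mono_set ((uIcc_subset_Icc hc hs).trans_eq (uIcc_of_le hab).symm)
    have hbound : ∀ᵐ q, q ∈ uIoc t s → ‖f' q‖ ≤ C.toNNReal := by
      filter_upwards [hC, Measure.ae_ne volume b] with q hq hqb hmem
      refine (hq ⟨(le_min ht.1 hs.1).trans_lt hmem.1, lt_of_le_of_ne ?_ hqb⟩).trans
        (Real.le_coe_toNNReal C)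
      exact hmem.2.trans (max_le ht.2 hs.2)
    rw [dist_eq_norm, intervalIntegral.integral_interval_sub_left (hint s hs) (hint t ht)]
    exact intervalIntegral.norm_integral_le_of_norm_le_const_ae hbound
  · filter_upwards [hf.ae_hasDerivAt_integral] with t ht hmem
    rw [uIcc_of_le hab] at ht
    exact ht (Ioo_subset_Icc_self hmem) c hc

lemma integral_eq_sub (hf : IsLipschitzPrimitiveOn f f' a b) (hab : a ≤ b) :
    ∫ s in a..b, f' s = f b - f a := by
  obtain ⟨C, hC⟩ := hf.exists_norm_deriv_le
  have hdiff := hf.sub (of_integral (hf.intervalIntegrable hab) hC (left_mem_Icc.2 hab))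
  obtain ⟨K, hK⟩ := hdiff.lipschitz
  rw [← uIcc_of_le hab] at hK
  obtain ⟨e, he⟩ := hK.absolutelyContinuousOnInterval.const_of_ae_hasDerivAt_zero (by
    filter_upwards [hdiff.deriv, Measure.ae_ne volume a, Measure.ae_ne volume b]
      with t ht hta htb hmem
    rw [uIcc_of_le hab] at hmem
    simpa only [sub_self] using ht ⟨hmem.1.lt_of_ne' hta, hmem.2.lt_of_ne htb⟩)
  have ha : f a = e := by simpa using he a left_mem_uIcc
  have hb : f b - ∫ s in a..b, f' s = e := he b right_mem_uIcc
  rw [ha, ← hb, sub_sub_cancel]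

end Complete

section Ring

variable {R : Type*} [NormedRing R] [NormedAlgebra ℝ R] {u u' v v' : ℝ → R}

lemma mul (hu : IsLipschitzPrimitiveOn u u' a b) (hv : IsLipschitzPrimitiveOn v v' a b) :
    IsLipschitzPrimitiveOn (fun t => u t * v t) (fun t => u t * v' t + u' t * v t) a b :=
  hu.bilinear (ContinuousLinearMap.mul ℝ R) hv

lemma integral_mul_mul [CompleteSpace R] (hu : IsLipschitzPrimitiveOn u u' a b) (hab : a ≤ b)
    (hv : ContinuousOn v (Icc a b)) (hv' : ContinuousOn v' (Icc a b)) :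
    IsLipschitzPrimitiveOn (fun t => ∫ s in a..t, v s * u' s * v' s)
      (fun t => v t * u' t * v' t) a b := by
  obtain ⟨C, hC⟩ := hu.exists_norm_deriv_le
  obtain ⟨L, hL⟩ := isCompact_Icc.exists_bound_of_continuousOn hv
  obtain ⟨K, hK⟩ := isCompact_Icc.exists_bound_of_continuousOn hv'
  have hint : IntervalIntegrable (fun t => v t * u' t * v' t) volume a b := by
    rw [← uIcc_of_le hab] at hv hv'
    exact ((hu.intervalIntegrable hab).continuousOn_mul hv).mul_continuousOn hv'
  refine of_integral hint (C := L * C * K) ?_ (left_mem_Icc.2 hab)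
  filter_upwards [hC] with t ht hmem
  exact norm_mul_le_of_le (norm_mul_le_of_le (hL t (Ioo_subset_Icc_self hmem)) (ht hmem))
    (hK t (Ioo_subset_Icc_self hmem))

end Ring

end IsLipschitzPrimitiveOn

end LipschitzPrimitive

section Fubini

variable {E F G : Type*} [NormedAddCommGroup E] [NormedSpace ℝ E] [NormedAddCommGroup F]
  [NormedSpace ℝ F] [NormedAddCommGroup G] [NormedSpace ℝ G] {μ : Measure ℝ} {a b : ℝ}

lemma integrableOn_bilinear_of_continuousOn (B : E →L[ℝ] F →L[ℝ] G) {S : Set ℝ}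
    (hS : IsCompact S) {f : ℝ → E} {k : ℝ → F} (hf : IntegrableOn f S μ)
    (hk : ContinuousOn k S) : IntegrableOn (fun t => B (f t) (k t)) S μ := by
  obtain ⟨C, hC⟩ := hS.exists_bound_of_continuousOn hk
  exact B.integrable_of_bilin_of_bdd_right C hf
    (hk.aestronglyMeasurable_of_isCompact hS hS.measurableSet)
    ((ae_restrict_iff' hS.measurableSet).2 (ae_of_all _ hC))

lemma intervalIntegrable_bilinear (B : E →L[ℝ] F →L[ℝ] G) (hab : a ≤ b) {f : ℝ → E} {k : ℝ → F}
    (hf : ContinuousOn f (Icc a b)) (hk : IntervalIntegrable k volume a b) :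
    IntervalIntegrable (fun t => B (f t) (k t)) volume a b := by
  rw [intervalIntegrable_iff_integrableOn_Icc_of_le hab] at hk ⊢
  exact integrableOn_bilinear_of_continuousOn B.flip isCompact_Icc hk hf

section Product

variable {α β : Type*} [MeasurableSpace α] [MeasurableSpace β] (B : E →L[ℝ] F →L[ℝ] G)
  {μ : Measure α} {ν : Measure β} {f : α → E} {g : β → F} {S : Set (α × β)}

lemma integrable_indicator_bilinear (hf : Integrable f μ) (hg : Integrable g ν)
    (hS : MeasurableSet S) : Integrable (S.indicator fun z => B (f z.1) (g z.2)) (μ.prod ν) :=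
  (hf.op_fst_snd (by fun_prop) ⟨‖B‖, B.le_opNorm₂⟩ hg).indicator hS

variable [CompleteSpace E] [CompleteSpace G]

lemma integral_indicator_bilinear_left (hf : Integrable f μ) (hS : MeasurableSet S) (q : β) :
    ∫ s, S.indicator (fun z => B (f z.1) (g z.2)) (s, q) ∂μ =
      B (∫ s in {s | (s, q) ∈ S}, f s ∂μ) (g q) := by
  have hsection : MeasurableSet {s | (s, q) ∈ S} := measurable_prodMk_right hS
  rw [← B.flip_apply, ← (B.flip (g q)).integral_comp_comm hf.integrableOn,
    ← integral_indicator hsection]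
  rfl

lemma integrable_bilinear_setIntegral [SFinite μ] [SFinite ν] (hf : Integrable f μ)
    (hg : Integrable g ν) (hS : MeasurableSet S) :
    Integrable (fun q => B (∫ s in {s | (s, q) ∈ S}, f s ∂μ) (g q)) ν := by
  simpa only [integral_indicator_bilinear_left B hf hS] using
    (integrable_indicator_bilinear B hf hg hS).integral_prod_right

lemma integral_bilinear_setIntegral_swap [SFinite μ] [SFinite ν] [CompleteSpace F]
    (hf : Integrable f μ) (hg : Integrable g ν) (hS : MeasurableSet S) :
    ∫ s, B (f s) (∫ q in {q | (s, q) ∈ S}, g q ∂ν) ∂μ =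
      ∫ q, B (∫ s in {s | (s, q) ∈ S}, f s ∂μ) (g q) ∂ν := by
  simp only [← integral_indicator_bilinear_left B hf hS]
  rw [← integral_integral_swap (f := fun s q => S.indicator (fun z => B (f z.1) (g z.2)) (s, q))
    (integrable_indicator_bilinear B hf hg hS)]
  refine integral_congr_ae (ae_of_all _ fun s => ?_)
  have hsection : MeasurableSet {q | (s, q) ∈ S} := measurable_prodMk_left hS
  beta_reduce
  rw [← (B (f s)).integral_comp_comm hg.integrableOn, ← integral_indicator hsection]
  rfl

end Product

lemma setIntegral_Ici_restrict_Icc {f : ℝ → E} {q : ℝ} (hq : a ≤ q) :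
    ∫ t in Ici q, f t ∂μ.restrict (Icc a b) = ∫ t in Icc q b, f t ∂μ := by
  rw [Measure.restrict_restrict measurableSet_Ici, ← Ici_inter_Iic, ← inter_assoc, Ici_inter_Ici,
    max_eq_left hq, Ici_inter_Iic]

namespace IsLipschitzPrimitiveOn

variable [SFinite μ] [CompleteSpace E] [CompleteSpace F] [CompleteSpace G]
  (B : E →L[ℝ] F →L[ℝ] G) {k k' : ℝ → F} (hk : IsLipschitzPrimitiveOn k k' a b) (hab : a ≤ b)
  {f : ℝ → E} (hf : IntegrableOn f (Icc a b) μ)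

include hk hab hf

lemma intervalIntegrable_bilinear_setIntegral :
    IntervalIntegrable (fun q => B (∫ t in Icc q b, f t ∂μ) (k' q)) volume a b := by
  rw [intervalIntegrable_iff_integrableOn_Ioc_of_le hab]
  have hk' : IntegrableOn k' (Ioc a b) :=
    (intervalIntegrable_iff_integrableOn_Ioc_of_le hab).1 (hk.intervalIntegrable hab)
  refine IntegrableOn.congr_fun (integrable_bilinear_setIntegral B hf hk'
    (S := {z | z.2 ≤ z.1}) (measurableSet_le measurable_snd measurable_fst)) (fun q hq => ?_)
    measurableSet_Ioc
  exact congrArg (B · (k' q)) (setIntegral_Ici_restrict_Icc hq.1.le)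

lemma setIntegral_bilinear :
    ∫ t in Icc a b, B (f t) (k t) ∂μ =
      B (∫ t in Icc a b, f t ∂μ) (k a) + ∫ q in a..b, B (∫ t in Icc q b, f t ∂μ) (k' q) := by
  have hk' : IntegrableOn k' (Ioc a b) :=
    (intervalIntegrable_iff_integrableOn_Ioc_of_le hab).1 (hk.intervalIntegrable hab)
  have hswap : ∫ t in Icc a b, B (f t) (∫ q in Iic t, k' q ∂volume.restrict (Ioc a b)) ∂μ =
      ∫ q in Ioc a b, B (∫ t in Ici q, f t ∂μ.restrict (Icc a b)) (k' q) :=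
    integral_bilinear_setIntegral_swap B hf hk' (measurableSet_le measurable_snd measurable_fst)
  have hleft : ∀ t ∈ Icc a b, ∫ q in Iic t, k' q ∂volume.restrict (Ioc a b) = k t - k a :=
    fun t ht => by
      rw [Measure.restrict_restrict measurableSet_Iic, inter_comm, Ioc_inter_Iic,
        min_eq_right ht.2, ← intervalIntegral.integral_of_le ht.1,
        (hk.mono le_rfl ht.2).integral_eq_sub ht.1]
  have hconst : IntegrableOn (fun t => B (f t) (k a)) (Icc a b) μ :=
    (B.flip (k a)).integrable_comp hf
  rw [setIntegral_congr_fun measurableSet_Icc fun t ht => congrArg (B (f t)) (hleft t ht),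
    setIntegral_congr_fun measurableSet_Ioc fun q hq =>
      congrArg (B · (k' q)) (setIntegral_Ici_restrict_Icc hq.1.le),
    ← intervalIntegral.integral_of_le hab] at hswap
  simp only [map_sub] at hswap
  rw [integral_sub (integrableOn_bilinear_of_continuousOn B isCompact_Icc hf hk.continuousOn)
    hconst] at hswap
  rw [← hswap, ← B.flip_apply, ← (B.flip (k a)).integral_comp_comm hf]
  simp only [B.flip_apply, add_sub_cancel]

end IsLipschitzPrimitiveOn

end Fubini

section ParameterDerivative

variable {E F G H : Type*} [NormedAddCommGroup E] [NormedSpace ℝ E] [NormedAddCommGroup F]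
  [NormedSpace ℝ F] [NormedAddCommGroup G] [NormedSpace ℝ G] [NormedAddCommGroup H]
  [NormedSpace ℝ H]

lemma exists_bound_fderiv_near_isCompact {k : E → F} {S : Set E} (hS : IsCompact S)
    (hk : ∀ y ∈ S, ContDiffAt ℝ 1 k y) :
    ∃ δ > 0, ∃ C : ℝ, ∀ z ∈ Metric.thickening δ S, ContDiffAt ℝ 1 k z ∧ ‖fderiv ℝ k z‖ ≤ C := by
  suffices h : ∃ C : ℝ, ∀ᶠ z in 𝓝ˢ S, ContDiffAt ℝ 1 k z ∧ ‖fderiv ℝ k z‖ ≤ C by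
    obtain ⟨C, hC⟩ := h
    obtain ⟨δ, hδ, hsub⟩ := (Metric.hasBasis_nhdsSet_thickening hS).eventually_iff.1 hC
    exact ⟨δ, hδ, C, fun z hz => hsub hz⟩
  have hcont : ∀ y ∈ S, ContinuousAt (fderiv ℝ k) y := fun y hy =>
    ((hk y hy).fderiv_right (m := 0) (by norm_num)).continuousAt
  obtain ⟨C, hC⟩ := hS.exists_bound_of_continuousOn
    (f := fderiv ℝ k) fun y hy => (hcont y hy).continuousWithinAt
  refine ⟨C + 1, eventually_nhdsSet_iff_forall.2 fun y hy => ?_⟩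
  filter_upwards [(hk y hy).eventually (by simp),
    (hcont y hy).norm.eventually_lt_const ((hC y hy).trans_lt (lt_add_one C))]
    with z hz hbound using ⟨hz, hbound.le⟩

lemma eventually_forall_add_smul_mem {S : Set ℝ} (hS : IsCompact S) {u v : ℝ → E}
    (hu : ContinuousOn u S) (hv : ContinuousOn v S) {U : Set E} (hU : IsOpen U)
    (hmem : ∀ t ∈ S, u t ∈ U) : ∀ᶠ ε : ℝ in 𝓝 0, ∀ t ∈ S, u t + ε • v t ∈ U := by
  obtain ⟨δ, hδ, hsub⟩ := (hS.image_of_continuousOn hu).exists_thickening_subset_open hU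
    (image_subset_iff.2 hmem)
  obtain ⟨V, hV⟩ := hS.exists_bound_of_continuousOn hv
  have hsmall : ∀ᶠ ε : ℝ in 𝓝 0, ‖ε‖ * V < δ :=
    (continuous_norm.mul continuous_const).continuousAt.eventually_lt continuousAt_const
      (by simpa using hδ)
  filter_upwards [hsmall] with ε hε t ht
  refine hsub (Metric.mem_thickening_iff.2 ⟨u t, mem_image_of_mem u ht, ?_⟩)
  rw [dist_self_add_left, norm_smul]
  exact (mul_le_mul_of_nonneg_left (hV t ht) (norm_nonneg ε)).trans_lt hε

lemma hasDerivAt_setIntegral_bilinear_comp (B : F →L[ℝ] G →L[ℝ] H) {ν : Measure ℝ} {S : Set ℝ}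
    (hS : IsCompact S) {u v : ℝ → E} (hu : ContinuousOn u S) (hv : ContinuousOn v S) {k : E → F}
    (hk : ∀ t ∈ S, ContDiffAt ℝ 1 k (u t)) {z : ℝ → G} (hz : IntegrableOn z S ν) :
    HasDerivAt (fun ε : ℝ => ∫ t in S, B (k (u t + ε • v t)) (z t) ∂ν)
      (∫ t in S, B (fderiv ℝ k (u t) (v t)) (z t) ∂ν) 0 := by
  obtain ⟨δ, hδ, C, hC⟩ := exists_bound_fderiv_near_isCompact (hS.image_of_continuousOn hu)
    (k := k) (forall_mem_image.2 hk)
  obtain ⟨V, hV⟩ := hS.exists_bound_of_continuousOn hv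
  have hnear : ∀ᶠ ε : ℝ in 𝓝 0, ∀ t ∈ S, u t + ε • v t ∈ Metric.thickening δ (u '' S) :=
    eventually_forall_add_smul_mem hS hu hv Metric.isOpen_thickening fun t ht =>
      Metric.self_subset_thickening hδ _ (mem_image_of_mem u ht)
  have hmeas : ∀ {w : ℝ → F}, ContinuousOn w S →
      IntegrableOn (fun t => B (w t) (z t)) S ν := fun hw =>
    integrableOn_bilinear_of_continuousOn B.flip hS hz hw
  have hmem : ∀ᶠ ε : ℝ in 𝓝 0, ContinuousOn (fun t => k (u t + ε • v t)) S :=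
    hnear.mono fun ε hε t ht => ContinuousAt.comp_continuousWithinAt
      (f := fun t => u t + ε • v t) (hC _ (hε t ht)).1.continuousAt
      ((hu.add (hv.const_smul ε)) t ht)
  refine (hasDerivAt_integral_of_dominated_loc_of_deriv_le
    (F' := fun ε t => B (fderiv ℝ k (u t + ε • v t) (v t)) (z t))
    (bound := fun t => ‖B‖ * (C * V) * ‖z t‖) hnear
    (hmem.mono fun ε hε => (hmeas hε).1) (hmeas hmem.self_of_nhds) ?_ ?_
    (hz.norm.const_mul _) ?_).2.congr_deriv (by simp only [zero_smul, add_zero])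
  · simp only [zero_smul, add_zero]
    refine (hmeas fun t ht => ContinuousWithinAt.clm_apply ?_ (hv t ht)).1
    exact (((hk t ht).fderiv_right (m := 0) (by norm_num)).continuousAt).comp_continuousWithinAt
      (hu t ht)
  · refine (ae_restrict_iff' hS.measurableSet).2 (ae_of_all _ fun t ht ε hε => ?_)
    refine (B.le_opNorm₂ _ _).trans ?_
    gcongr
    exact (ContinuousLinearMap.le_opNorm _ _).trans (mul_le_mul (hC _ (hε t ht)).2 (hV t ht)
      (norm_nonneg _) ((norm_nonneg _).trans (hC _ (hε t ht)).2))
  · refine (ae_restrict_iff' hS.measurableSet).2 (ae_of_all _ fun t ht ε hε => ?_)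
    have hline : HasDerivAt (fun ε : ℝ => u t + ε • v t) (v t) ε := by
      simpa using ((hasDerivAt_id ε).smul_const (v t)).const_add (u t)
    have hkt := ((hC _ (hε t ht)).1.differentiableAt one_ne_zero).hasFDerivAt
    exact (B.flip (z t)).hasFDerivAt.comp_hasDerivAt ε (hkt.comp_hasDerivAt ε hline)

lemma hasDerivAt_setIntegral_bilinear_comp_add_smul (B : F →L[ℝ] G →L[ℝ] H) {ν : Measure ℝ}
    {S : Set ℝ} (hS : IsCompact S) {u v : ℝ → E} (hu : ContinuousOn u S) (hv : ContinuousOn v S)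
    {k : E → F} (hk : ∀ t ∈ S, ContDiffAt ℝ 1 k (u t)) {z w : ℝ → G} (hz : IntegrableOn z S ν)
    (hw : IntegrableOn w S ν) :
    HasDerivAt (fun ε : ℝ => ∫ t in S, B (k (u t + ε • v t)) (z t + ε • w t) ∂ν)
      (∫ t in S, B (fderiv ℝ k (u t) (v t)) (z t) + B (k (u t)) (w t) ∂ν) 0 := by
  let B₂ : F × F →L[ℝ] G × G →L[ℝ] H :=
    B.bilinearComp (.fst ℝ F F) (.fst ℝ G G) + B.bilinearComp (.snd ℝ F F) (.snd ℝ G G)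
  let k₂ : E × ℝ → F × F := fun y => (k y.1, y.2 • k y.1)
  have hk₁ : ∀ t ∈ S, ContDiffAt ℝ 1 (fun y : E × ℝ => k y.1) (u t, 0) := fun t ht =>
    (hk t ht).comp (u t, (0 : ℝ)) contDiffAt_fst
  have hfderiv : ∀ t ∈ S, fderiv ℝ k₂ (u t, 0) (v t, 1) =
      (fderiv ℝ k (u t) (v t), k (u t)) := fun t ht => by
    have hfst : HasFDerivAt (fun y : E × ℝ => k y.1)
        ((fderiv ℝ k (u t)).comp (.fst ℝ E ℝ)) (u t, 0) :=
      ((hk t ht).differentiableAt one_ne_zero).hasFDerivAt.comp (u t, (0 : ℝ)) hasFDerivAt_fst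
    have hk₂ : HasFDerivAt k₂ _ (u t, 0) := hfst.prodMk (hasFDerivAt_snd.smul hfst)
    rw [hk₂.fderiv]
    simp
  refine ((hasDerivAt_setIntegral_bilinear_comp B₂ hS (u := fun t => (u t, (0 : ℝ)))
    (v := fun t => (v t, (1 : ℝ))) (hu.prodMk continuousOn_const) (hv.prodMk continuousOn_const)
    (k := k₂) (fun t ht => (hk₁ t ht).prodMk (contDiffAt_snd.smul (hk₁ t ht)))
    (z := fun t => (z t, w t)) (hz.prodMk hw)).congr_of_eventuallyEq ?_).congr_deriv ?_
  · refine Eventually.of_forall fun ε => integral_congr_ae (ae_of_all _ fun t => ?_)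
    simp [B₂, k₂]
  · refine setIntegral_congr_fun hS.measurableSet fun t ht => ?_
    simp [B₂, hfderiv t ht]

end ParameterDerivative

section PosSemidefTrace

open scoped ComplexOrder

variable {𝕜 n : Type*} [RCLike 𝕜] [Fintype n] {A B F : Matrix n n 𝕜}

lemma exists_eq_conjTranspose_mul_self (hA : A.PosSemidef) : ∃ C, A = C.conjTranspose * C := by
  classical
  open scoped MatrixOrder in exact CStarAlgebra.nonneg_iff_eq_star_mul_self.1 hA.nonneg

lemma trace_mul_nonneg (hA : A.PosSemidef) (hB : B.PosSemidef) : 0 ≤ (A * B).trace := by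
  obtain ⟨C, rfl⟩ := exists_eq_conjTranspose_mul_self hB
  rw [← Matrix.mul_assoc, Matrix.trace_mul_comm, ← Matrix.mul_assoc]
  exact (hA.mul_mul_conjTranspose_same C).trace_nonneg

lemma mul_eq_zero_of_trace_mul_eq_zero (hA : A.PosSemidef) (hB : B.PosSemidef)
    (h : (A * B).trace = 0) : A * B = 0 := by
  obtain ⟨C, rfl⟩ := exists_eq_conjTranspose_mul_self hB
  obtain ⟨D, rfl⟩ := exists_eq_conjTranspose_mul_self hA
  have hDC : D * C.conjTranspose = 0 := by
    refine Matrix.trace_conjTranspose_mul_self_eq_zero_iff.1 (h ▸ ?_)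
    rw [Matrix.conjTranspose_mul, Matrix.conjTranspose_conjTranspose, Matrix.mul_assoc,
      Matrix.trace_mul_comm]
    simp only [Matrix.mul_assoc]
  rw [Matrix.mul_assoc, ← Matrix.mul_assoc D, hDC, Matrix.zero_mul, Matrix.mul_zero]

lemma trace_mul_conj_eq_trace_conjTranspose_mul_self (hF : F.IsHermitian) (C : Matrix n n 𝕜) :
    (F * (C.conjTranspose * C * F * (C.conjTranspose * C))).trace =
      ((C * F * C.conjTranspose).conjTranspose * (C * F * C.conjTranspose)).trace := by
  simp only [Matrix.conjTranspose_mul, Matrix.conjTranspose_conjTranspose, hF.eq,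
    Matrix.mul_assoc]
  rw [← Matrix.mul_assoc, ← Matrix.mul_assoc, Matrix.trace_mul_comm C]
  simp only [Matrix.mul_assoc]

lemma trace_mul_conj_nonneg (hF : F.IsHermitian) (hA : A.PosSemidef) :
    0 ≤ (F * (A * F * A)).trace := by
  obtain ⟨C, rfl⟩ := exists_eq_conjTranspose_mul_self hA
  rw [trace_mul_conj_eq_trace_conjTranspose_mul_self hF]
  exact (Matrix.posSemidef_conjTranspose_mul_self _).trace_nonneg

lemma eq_zero_of_trace_mul_conj_eq_zero (hF : F.IsHermitian) (hA : A.PosDef)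
    (h : (F * (A * F * A)).trace = 0) : F = 0 := by
  classical
  obtain ⟨C, rfl⟩ := exists_eq_conjTranspose_mul_self hA.posSemidef
  rw [trace_mul_conj_eq_trace_conjTranspose_mul_self hF,
    Matrix.trace_conjTranspose_mul_self_eq_zero_iff] at h
  have hC : IsUnit C := isUnit_of_mul_isUnit_right hA.isUnit
  rwa [((Matrix.isUnit_conjTranspose _).2 hC).mul_left_eq_zero, hC.mul_right_eq_zero] at h

end PosSemidefTrace

section RealPosSemidef

variable {n : Type*} {A B M : Matrix n n ℝ}

lemma sq_entry_le [Finite n] (hA : A.PosSemidef) (i j : n) : A i j ^ 2 ≤ A i i * A j j := by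
  have := Fintype.ofFinite n
  obtain ⟨C, rfl⟩ := exists_eq_conjTranspose_mul_self hA
  simp only [Matrix.mul_apply, Matrix.conjTranspose_apply, star_trivial, ← sq]
  exact Finset.sum_mul_sq_le_sq_mul_sq _ _ _

lemma abs_entry_le_one_of_posSemidef_sub [Finite n] (hA : A.PosSemidef)
    (hBA : (B - A).PosSemidef) (hB : ∀ i, B i i = 1) (i j : n) : |A i j| ≤ 1 := by
  have hdiag : ∀ i, A i i ≤ 1 := fun i => by
    simpa only [Matrix.sub_apply, hB i, sub_nonneg] using hBA.diag_nonneg (i := i)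
  exact (sq_le_one_iff_abs_le_one _).1
    ((sq_entry_le hA i j).trans (mul_le_one₀ (hdiag i) hA.diag_nonneg (hdiag j)))

lemma posSemidef_vecMulVec_self [Finite n] (v : n → ℝ) : (Matrix.vecMulVec v v).PosSemidef :=
  Matrix.posSemidef_vecMulVec_self_star v

lemma isClosed_posSemidef [Finite n] : IsClosed {A : Matrix n n ℝ | A.PosSemidef} := by
  have := Fintype.ofFinite n
  simp only [Matrix.posSemidef_iff_dotProduct_mulVec, Matrix.IsHermitian, ofPred_and, ofPred_forall]
  exact (isClosed_eq (by fun_prop) continuous_id).inter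
    (isClosed_iInter fun v => isClosed_le continuous_const (by fun_prop))

lemma eventually_posDef_add_smul [Finite n] (hA : A.PosDef) (hM : M.IsHermitian) :
    ∀ᶠ ε in 𝓝 (0 : ℝ), (A + ε • M).PosDef := by
  have := Fintype.ofFinite n
  have hsphere : ∀ᶠ ε in 𝓝 (0 : ℝ), ∀ v ∈ Metric.sphere (0 : n → ℝ) 1,
      0 < v ⬝ᵥ (A + ε • M).mulVec v := by
    refine (isCompact_sphere _ _).eventually_forall_of_forall_eventually fun v hv => ?_
    have hcont : Continuous fun z : ℝ × (n → ℝ) => z.2 ⬝ᵥ (A + z.1 • M).mulVec z.2 := by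
      fun_prop
    have hv0 : v ≠ 0 := ne_zero_of_mem_unit_sphere ⟨v, hv⟩
    exact hcont.continuousAt.eventually
      (lt_mem_nhds (by simpa using hA.dotProduct_mulVec_pos hv0))
  filter_upwards [hsphere] with ε hε
  refine Matrix.PosDef.of_dotProduct_mulVec_pos (hA.isHermitian.add (hM.smul (IsSelfAdjoint.all ε)))
    fun v hv => ?_
  have hv' : 0 < ‖v‖⁻¹ := inv_pos.2 (norm_pos_iff.2 hv)
  have hunit := hε (‖v‖⁻¹ • v) (by simp [norm_smul, hv])
  rw [Matrix.mulVec_smul, smul_dotProduct, dotProduct_smul, smul_eq_mul, smul_eq_mul] at hunit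
  exact pos_of_mul_pos_right (pos_of_mul_pos_right hunit hv'.le) hv'.le

lemma posSemidef_of_hasDerivAt [Finite n] {f : ℝ → Matrix n n ℝ} {t : ℝ}
    (hf : HasDerivAt f A t) (hmono : ∀ᶠ s in 𝓝[>] t, (f s - f t).PosSemidef) : A.PosSemidef := by
  have := Fintype.ofFinite n
  classical
  have hslope := (hasDerivWithinAt_iff_tendsto_slope (F := Matrix n n ℝ)).1
    (hf.hasDerivWithinAt (s := Ioi t))
  rw [sdiff_singleton_eq_self self_notMem_Ioi] at hslope
  refine isClosed_posSemidef.mem_of_tendsto hslope ?_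
  filter_upwards [hmono, self_mem_nhdsWithin] with s hs hts
  rw [slope_def_module]
  exact hs.smul (inv_nonneg.2 (sub_nonneg.2 hts.le))

variable [Fintype n]

lemma posSemidef_mul_mul_same (hA : A.IsHermitian) (hB : B.PosSemidef) :
    (A * B * A).PosSemidef := by
  simpa only [hA.eq] using hB.conjTranspose_mul_mul_same A

lemma isHermitian_integral [DecidableEq n] {α : Type*} [MeasurableSpace α] {μ : Measure α}
    {f : α → Matrix n n ℝ} (hf : ∀ᵐ s ∂μ, (f s).IsHermitian) : (∫ s, f s ∂μ).IsHermitian :=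
  ((starL' ℝ : Matrix n n ℝ ≃L[ℝ] _).integral_comp_comm f).symm.trans (integral_congr_ae hf)

lemma posSemidef_integral [DecidableEq n] {α : Type*} [MeasurableSpace α] {μ : Measure α}
    {f : α → Matrix n n ℝ} (hf : ∀ᵐ s ∂μ, (f s).PosSemidef) : (∫ s, f s ∂μ).PosSemidef := by
  by_cases hint : Integrable f μ
  · refine Matrix.PosSemidef.of_dotProduct_mulVec_nonneg ?_ fun v => ?_
    · exact isHermitian_integral (hf.mono fun s hs => hs.isHermitian)
    · let quadForm : Matrix n n ℝ →ₗ[ℝ] ℝ :=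
        { toFun := fun A => star v ⬝ᵥ A.mulVec v
          map_add' := fun A B => by rw [Matrix.add_mulVec, dotProduct_add]
          map_smul' := fun r A => by rw [Matrix.smul_mulVec, dotProduct_smul, RingHom.id_apply] }
      refine (integral_nonneg_of_ae (hf.mono fun s hs => hs.dotProduct_mulVec_nonneg v)).trans_eq ?_
      exact quadForm.toContinuousLinearMap.integral_comp_comm hint
  · rw [integral_undef hint]
    exact Matrix.PosSemidef.zero

end RealPosSemidef

section MatrixCalculus

variable {n : Type*} [Fintype n] [DecidableEq n] {A M : Matrix n n ℝ} {a b : ℝ}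

lemma hasDerivAt_log_det_add_smul (hA : IsUnit A.det) (M : Matrix n n ℝ) :
    HasDerivAt (fun ε : ℝ => Real.log (A + ε • M).det) (A⁻¹ * M).trace 0 := by
  have hfactor : ∀ ε : ℝ, (A + ε • M).det = A.det * (1 + ε • (A⁻¹ * M)).det := fun ε => by
    rw [← Matrix.det_mul, Matrix.mul_add, Matrix.mul_one, Matrix.mul_smul,
      Matrix.mul_nonsing_inv_cancel_left _ _ hA]
  obtain ⟨p, hp⟩ : ∃ p : Polynomial ℝ, ∀ ε : ℝ, (1 + ε • (A⁻¹ * M)).det =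
      1 + (A⁻¹ * M).trace * ε + p.eval ε * ε ^ 2 := ⟨_, fun ε => Matrix.det_one_add_smul ε _⟩
  have hdet : HasDerivAt (fun ε : ℝ => (1 + ε • (A⁻¹ * M)).det) (A⁻¹ * M).trace 0 := by
    simp only [hp]
    have hlinear := ((hasDerivAt_id (0 : ℝ)).const_mul (A⁻¹ * M).trace).const_add 1
    exact (hlinear.add ((p.hasDerivAt 0).mul ((hasDerivAt_id (0 : ℝ)).pow 2))).congr_deriv
      (by simp)
  simp only [hfactor]
  refine ((hdet.const_mul A.det).log (by simpa using hA.ne_zero)).congr_deriv ?_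
  simp [hA.ne_zero]

lemma contDiffAt_matrix_inv (hA : IsUnit A) : ContDiffAt ℝ 1 (fun B : Matrix n n ℝ => B⁻¹) A := by
  obtain ⟨u, rfl⟩ := hA
  simpa only [Matrix.nonsing_inv_eq_ringInverse] using contDiffAt_ringInverse ℝ u

lemma fderiv_matrix_inv (hA : IsUnit A) (M : Matrix n n ℝ) :
    fderiv ℝ (fun B : Matrix n n ℝ => B⁻¹) A M = -(A⁻¹ * M * A⁻¹) := by
  obtain ⟨u, rfl⟩ := hA
  simp only [Matrix.nonsing_inv_eq_ringInverse, Ring.inverse_unit]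
  rw [show (fun B : Matrix n n ℝ => Ring.inverse B) = Ring.inverse from rfl, fderiv_inverse]
  rfl

lemma IsLipschitzPrimitiveOn.matrixInv {u u' : ℝ → Matrix n n ℝ}
    (hu : IsLipschitzPrimitiveOn u u' a b) (hunit : ∀ t ∈ Icc a b, IsUnit (u t)) :
    IsLipschitzPrimitiveOn (fun t => (u t)⁻¹) (fun t => -((u t)⁻¹ * u' t * (u t)⁻¹)) a b :=
  (hu.contDiffAt_comp fun t ht => contDiffAt_matrix_inv (hunit t ht)).congr_deriv
    (ae_of_all _ fun t ht => fderiv_matrix_inv (hunit t (Ioo_subset_Icc_self ht)) (u' t))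

end MatrixCalculus

section FrobeniusProduct

variable {m : ℕ}

/-- The Frobenius inner product as a continuous bilinear form. -/
def frobCLM : Matrix (Fin m) (Fin m) ℝ →L[ℝ] Matrix (Fin m) (Fin m) ℝ →L[ℝ] ℝ :=
  (LinearMap.mk₂ ℝ frob
    (fun A B C => by simp only [frob, Matrix.add_apply, add_mul, Finset.sum_add_distrib])
    (fun r A B => by simp only [frob, Matrix.smul_apply, smul_eq_mul, mul_assoc, Finset.mul_sum])
    (fun A B C => by simp only [frob, Matrix.add_apply, mul_add, Finset.sum_add_distrib])
    (fun r A B => by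
      simp only [frob, Matrix.smul_apply, smul_eq_mul, mul_left_comm, Finset.mul_sum]
      )).toContinuousBilinearMap

variable (A B : Matrix (Fin m) (Fin m) ℝ)

@[simp] lemma frobCLM_apply : frobCLM A B = frob A B := rfl

lemma frob_comm : frob A B = frob B A := by
  simp only [frob, mul_comm]

lemma frob_eq_trace : frob A B = (A.conjTranspose * B).trace := by
  simp only [frob, Matrix.trace, Matrix.diag, Matrix.mul_apply, Matrix.conjTranspose_apply,
    star_trivial]
  exact Finset.sum_comm

lemma frob_vecMulVec_self (v : Fin m → ℝ) :
    frob A (Matrix.vecMulVec v v) = v ⬝ᵥ A.mulVec v := by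
  simp only [frob, Matrix.vecMulVec_apply, dotProduct, Matrix.mulVec, Finset.mul_sum,
    mul_left_comm]

variable {A B}

lemma frob_conj_comm {C : Matrix (Fin m) (Fin m) ℝ} (hC : C.IsHermitian) :
    frob (C * A * C) B = frob (C * B * C) A := by
  rw [frob_comm (C * B * C), frob_eq_trace, frob_eq_trace, Matrix.conjTranspose_mul,
    Matrix.conjTranspose_mul, hC.eq, Matrix.mul_assoc, Matrix.trace_mul_comm]
  simp only [Matrix.mul_assoc]

lemma hasDerivAt_frob_inv_add_smul_smul (hA : IsUnit A) (M : Matrix (Fin m) (Fin m) ℝ) :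
    HasDerivAt (fun ε : ℝ => frob (A + ε • M)⁻¹ (ε • B)) (frob A⁻¹ B) 0 := by
  have hline : HasDerivAt (fun ε : ℝ => A + ε • M) M 0 := by
    simpa using ((hasDerivAt_id (0 : ℝ)).smul_const M).const_add A
  have hinv : HasDerivAt (fun ε : ℝ => (A + ε • M)⁻¹) _ 0 :=
    ((contDiffAt_matrix_inv (A := A + (0 : ℝ) • M) (by simpa using hA)).differentiableAt
      one_ne_zero).hasFDerivAt.comp_hasDerivAt 0 hline
  have hfrob := (frobCLM.flip B).hasFDerivAt.comp_hasDerivAt 0 hinv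
  simp only [← frobCLM_apply, map_smul, smul_eq_mul]
  refine ((hasDerivAt_id (0 : ℝ)).mul hfrob).congr_deriv ?_
  simp

lemma frob_nonneg (hA : A.PosSemidef) (hB : B.PosSemidef) : 0 ≤ frob A B := by
  simpa only [frob_eq_trace, hA.isHermitian.eq] using trace_mul_nonneg hA hB

lemma sqrt_frob_self_le_trace (hA : A.PosSemidef) : √(frob A A) ≤ A.trace := by
  rw [Real.sqrt_le_left hA.trace_nonneg]
  calc frob A A ≤ ∑ i, ∑ j, A i i * A j j :=
        Finset.sum_le_sum fun i _ => Finset.sum_le_sum fun j _ =>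
          (sq (A i j)).symm.trans_le (sq_entry_le hA i j)
    _ = A.trace ^ 2 := by
        simp only [Matrix.trace, Matrix.diag, sq, Finset.sum_mul_sum]

end FrobeniusProduct

lemma analyticOnNhd_tsum_mul_pow {c : ℕ → ℝ} {r : ℝ} (hr : 0 < r)
    (hc : Summable fun p => |c p| * r ^ p) :
    AnalyticOnNhd ℝ (fun z => ∑' p, c p * z ^ p) (Metric.ball 0 r) := by
  set q := FormalMultilinearSeries.ofScalars ℝ c with hq
  have hradius : ENNReal.ofReal r ≤ q.radius :=
    q.le_radius_of_summable (r := r.toNNReal)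
      (by simpa only [hq, FormalMultilinearSeries.ofScalars_norm, Real.norm_eq_abs,
        Real.coe_toNNReal _ hr.le] using hc)
  have hsum : (fun z => ∑' p, c p * z ^ p) = q.sum := by
    funext z
    exact (FormalMultilinearSeries.ofScalars_sum_eq c z).symm
  rw [hsum, ← Metric.eball_ofReal]
  exact ((q.hasFPowerSeriesOnBall
    ((ENNReal.ofReal_pos.2 hr).trans_le hradius)).mono (ENNReal.ofReal_pos.2 hr)
      hradius).analyticOnNhd

lemma hasDerivAt_intervalIntegral_of_continuousOn_ball {f : ℝ → ℝ} {r z : ℝ}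
    (hf : ContinuousOn f (Metric.ball 0 r)) (hz : z ∈ Metric.ball 0 r) :
    HasDerivAt (fun w => ∫ y in (0 : ℝ)..w, f y) (f z) z := by
  have hsegment : uIcc 0 z ⊆ Metric.ball 0 r := by
    rw [← segment_eq_uIcc]
    exact (convex_ball _ _).segment_subset
      (Metric.mem_ball_self (Metric.pos_of_mem_ball hz)) hz
  exact intervalIntegral.integral_hasDerivAt_right (hf.mono hsegment).intervalIntegrable
    (hf.stronglyMeasurableAtFilter Metric.isOpen_ball z hz)
    (hf.continuousAt (Metric.isOpen_ball.mem_nhds hz))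

lemma posSemidef_hadamard_pow_sub {n : Type*} {X Y : Matrix n n ℝ}
    (hX : X.PosSemidef) (hY : Y.PosSemidef) (hXY : (Y - X).PosSemidef) (k : ℕ) :
    (Matrix.of fun i j => Y i j ^ (k + 1)).PosSemidef ∧
      (Matrix.of fun i j => Y i j ^ (k + 1) - X i j ^ (k + 1)).PosSemidef := by
  induction k with
  | zero =>
    simp only [zero_add, pow_one]
    exact ⟨hY, hXY⟩
  | succ k ih =>
    have hpow : (Matrix.of fun i j => Y i j ^ (k + 1 + 1)) =
        (Matrix.of fun i j => Y i j ^ (k + 1)).hadamard Y := by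
      ext i j
      simp [pow_succ]
    have hpow_sub : (Matrix.of fun i j => Y i j ^ (k + 1 + 1) - X i j ^ (k + 1 + 1)) =
        (Matrix.of fun i j => Y i j ^ (k + 1)).hadamard (Y - X) +
          (Matrix.of fun i j => Y i j ^ (k + 1) - X i j ^ (k + 1)).hadamard X := by
      ext i j
      simp only [Matrix.of_apply, Matrix.add_apply, Matrix.hadamard_apply, Matrix.sub_apply]
      ring
    rw [hpow, hpow_sub]
    exact ⟨ih.1.hadamard hY, (ih.1.hadamard hXY).add (ih.2.hadamard hX)⟩

section Covariance

variable {m : ℕ} {β : ℕ → Fin m → ℝ} {A X Y : Matrix (Fin m) (Fin m) ℝ}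

/-- The entry `(i, j)` of `ξ'`, as a function of the overlap. -/
def xiEntryDeriv (β : ℕ → Fin m → ℝ) (i j : Fin m) (z : ℝ) : ℝ :=
  ∑' p : ℕ, ((p : ℝ) + 2) * (β (p + 2) i * β (p + 2) j) * z ^ (p + 1)

/-- The sum of the entries of `ξ(A) + (h hᵀ) ⊙ A`, a potential for `ξ'(A) + h hᵀ`; the entries of
`ξ` are written as primitives of those of `ξ'`. -/
def xiTotal (β : ℕ → Fin m → ℝ) (h : Fin m → ℝ) (A : Matrix (Fin m) (Fin m) ℝ) : ℝ :=
  (∑ i, ∑ j, ∫ z in (0 : ℝ)..A i j, xiEntryDeriv β i j z) + frob (Matrix.vecMulVec h h) A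

lemma xiPrime_zero : xiPrime β (0 : Matrix (Fin m) (Fin m) ℝ) = 0 := by
  ext i j
  simp [xiPrime]

lemma isHermitian_xiPrime (hA : A.IsHermitian) : (xiPrime β A).IsHermitian := by
  ext i j
  simp only [xiPrime, Matrix.conjTranspose_apply, Matrix.of_apply, star_trivial]
  simp only [show A j i = A i j by simpa using hA.apply i j, mul_comm (β _ j)]

section Summable

variable (hβ : ∀ j, Summable fun p : ℕ => (2 : ℝ) ^ p * β p j ^ 2)

include hβ

lemma summable_xiPrime_coeff (i j : Fin m) :
    Summable fun p : ℕ => |((p : ℝ) + 2) * (β (p + 2) i * β (p + 2) j)| * (8 / 5) ^ p := by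
  have hshift : ∀ j, Summable fun p : ℕ => (2 : ℝ) ^ (p + 2) * β (p + 2) j ^ 2 :=
    fun j => (summable_nat_add_iff 2).2 (hβ j)
  refine .of_nonneg_of_le (fun p => by positivity) (fun p => ?_) ((hshift i).add (hshift j))
  have hbernoulli : (p : ℝ) + 2 ≤ 8 * (5 / 4) ^ p := by
    have := one_add_mul_le_pow (by norm_num : (-2 : ℝ) ≤ 1 / 4) p
    norm_num at this
    linarith [(Nat.cast_nonneg p : (0 : ℝ) ≤ p)]
  have hamgm : 2 * |β (p + 2) i * β (p + 2) j| ≤ β (p + 2) i ^ 2 + β (p + 2) j ^ 2 := by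
    simpa only [abs_mul, sq_abs, mul_assoc] using
      two_mul_le_add_sq |β (p + 2) i| |β (p + 2) j|
  calc |((p : ℝ) + 2) * (β (p + 2) i * β (p + 2) j)| * (8 / 5) ^ p
      = ((p : ℝ) + 2) * |β (p + 2) i * β (p + 2) j| * (8 / 5) ^ p := by
        rw [abs_mul, abs_of_nonneg (by positivity : (0 : ℝ) ≤ p + 2)]
    _ ≤ 8 * (5 / 4) ^ p * |β (p + 2) i * β (p + 2) j| * (8 / 5) ^ p := by gcongr
    _ = 4 * (5 / 4 * (8 / 5)) ^ p * (2 * |β (p + 2) i * β (p + 2) j|) := by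
        rw [mul_pow]
        ring
    _ ≤ 4 * (5 / 4 * (8 / 5)) ^ p * (β (p + 2) i ^ 2 + β (p + 2) j ^ 2) := by gcongr
    _ = 2 ^ (p + 2) * β (p + 2) i ^ 2 + 2 ^ (p + 2) * β (p + 2) j ^ 2 := by
        rw [show (5 / 4 * (8 / 5) : ℝ) = 2 by norm_num, pow_add]
        ring

lemma analyticOnNhd_xiEntryDeriv (i j : Fin m) :
    AnalyticOnNhd ℝ (xiEntryDeriv β i j) (Metric.ball 0 (8 / 5)) := by
  have hfactor : xiEntryDeriv β i j = fun z =>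
      z * ∑' p : ℕ, ((p : ℝ) + 2) * (β (p + 2) i * β (p + 2) j) * z ^ p := by
    funext z
    rw [xiEntryDeriv, ← tsum_mul_left]
    exact tsum_congr fun p => by ring
  rw [hfactor]
  exact analyticOnNhd_id.mul
    (analyticOnNhd_tsum_mul_pow (by norm_num) (summable_xiPrime_coeff hβ i j))

lemma contDiffAt_xiPrime (hA : ∀ i j, |A i j| < 8 / 5) : ContDiffAt ℝ 1 (xiPrime β) A := by
  have hentries : xiPrime β = fun A : Matrix (Fin m) (Fin m) ℝ =>
      ∑ i, ∑ j, xiEntryDeriv β i j (A i j) • Matrix.single i j (1 : ℝ) := by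
    funext A
    simp only [Matrix.smul_single, smul_eq_mul, mul_one]
    exact Matrix.matrix_eq_sum_single (xiPrime β A)
  rw [hentries]
  refine ContDiffAt.sum fun i _ => ContDiffAt.sum fun j _ => ?_
  have hentry : ContDiffAt ℝ 1 (fun A : Matrix (Fin m) (Fin m) ℝ => A i j) A :=
    (Matrix.entryLinearMap ℝ ℝ i j).toContinuousLinearMap.contDiff.contDiffAt
  have hderiv : ContDiffAt ℝ 1 (xiEntryDeriv β i j) (A i j) :=
    (analyticOnNhd_xiEntryDeriv hβ i j _ (by simpa using hA i j)).contDiffAt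
  have hcomp : ContDiffAt ℝ 1
      (fun A : Matrix (Fin m) (Fin m) ℝ => xiEntryDeriv β i j (A i j)) A :=
    ContDiffAt.comp (g := xiEntryDeriv β i j) A hderiv hentry
  exact hcomp.smul contDiffAt_const

lemma hasFDerivAt_xiTotal (h : Fin m → ℝ) (hA : ∀ i j, |A i j| < 8 / 5) :
    HasFDerivAt (xiTotal β h) (frobCLM (xiPrime β A + Matrix.vecMulVec h h)) A := by
  have hentry : ∀ i j, HasFDerivAt
      (fun A : Matrix (Fin m) (Fin m) ℝ => ∫ z in (0 : ℝ)..A i j, xiEntryDeriv β i j z)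
      (xiPrime β A i j • (Matrix.entryLinearMap ℝ ℝ i j).toContinuousLinearMap) A := fun i j =>
    (hasDerivAt_intervalIntegral_of_continuousOn_ball
      (analyticOnNhd_xiEntryDeriv hβ i j).continuousOn
      (by simpa using hA i j)).comp_hasFDerivAt (h₂ := fun w => ∫ z in (0 : ℝ)..w, _) A
      (Matrix.entryLinearMap ℝ ℝ i j).toContinuousLinearMap.hasFDerivAt
  refine ((HasFDerivAt.fun_sum fun i _ => HasFDerivAt.fun_sum fun j _ => hentry i j).add
    (frobCLM (Matrix.vecMulVec h h)).hasFDerivAt).congr_fderiv ?_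
  ext M
  simp [map_add, frob]

lemma contDiffAt_xiTotal (h : Fin m → ℝ) (hA : ∀ i j, |A i j| < 8 / 5) :
    ContDiffAt ℝ 1 (xiTotal β h) A := by
  have hopen : IsOpen {A : Matrix (Fin m) (Fin m) ℝ | ∀ i j, |A i j| < 8 / 5} := by
    simp only [ofPred_forall]
    exact isOpen_iInter_of_finite fun i => isOpen_iInter_of_finite fun j =>
      isOpen_lt (Matrix.entryLinearMap ℝ ℝ i j).toContinuousLinearMap.continuous.abs
        continuous_const
  exact contDiffAt_one_iff.2 ⟨_, _, hopen.mem_nhds hA, fun B hB =>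
    (frobCLM.continuous.continuousAt.comp ((contDiffAt_xiPrime hβ hB).continuousAt.add
      continuousAt_const)).continuousWithinAt, fun B hB => hasFDerivAt_xiTotal hβ h hB⟩

lemma posSemidef_xiPrime_sub (hX : X.PosSemidef) (hY : Y.PosSemidef) (hXY : (Y - X).PosSemidef)
    (hX1 : ∀ i j, |X i j| < 8 / 5) (hY1 : ∀ i j, |Y i j| < 8 / 5) :
    (xiPrime β Y - xiPrime β X).PosSemidef := by
  have hsummable : ∀ i j {z : ℝ}, |z| < 8 / 5 → Summable fun p : ℕ =>
      ((p : ℝ) + 2) * (β (p + 2) i * β (p + 2) j) * z ^ (p + 1) := fun i j z hz => by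
    refine .of_norm_bounded ((summable_xiPrime_coeff hβ i j).mul_right (8 / 5)) fun p => ?_
    rw [norm_mul, norm_pow, Real.norm_eq_abs, Real.norm_eq_abs, mul_assoc, ← pow_succ]
    gcongr
  set term : ℕ → Matrix (Fin m) (Fin m) ℝ := fun p => ((p : ℝ) + 2) •
    (Matrix.vecMulVec (β (p + 2)) (β (p + 2))).hadamard
      (Matrix.of fun i j => Y i j ^ (p + 1) - X i j ^ (p + 1)) with hterm
  have hterm_posSemidef : ∀ p, (term p).PosSemidef := fun p =>
    ((posSemidef_vecMulVec_self _).hadamard (posSemidef_hadamard_pow_sub hX hY hXY p).2).smul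
      (by positivity)
  have hsum : HasSum term (xiPrime β Y - xiPrime β X) := by
    refine Pi.hasSum.2 fun i => Pi.hasSum.2 fun j => ?_
    refine ((hsummable i j (hY1 i j)).hasSum.sub (hsummable i j (hX1 i j)).hasSum).congr_fun ?_
    intro p
    simp only [hterm, Matrix.smul_apply, Matrix.hadamard_apply, Matrix.vecMulVec_apply,
      Matrix.of_apply, smul_eq_mul]
    ring
  exact isClosed_posSemidef.mem_of_tendsto hsum
    (Eventually.of_forall fun s => Matrix.posSemidef_sum _ fun p _ => hterm_posSemidef p)

end Summable

end Covariance

section WeightedTail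

variable {E : Type*} [NormedAddCommGroup E] [NormedSpace ℝ E] {m : ℕ} {x : ℝ → ℝ} {τ : ℝ}

/-- `R + ∫_t^τ x D`. For `R = Q - Φ τ`, `D = Φ'` and a truncation point `τ` this is `Φ̂ t`; the
variation of `Φ̂` along a direction of variation of `Φ` is of the same form. -/
def weightedTail (x : ℝ → ℝ) (τ : ℝ) (R : E) (D : ℝ → E) (t : ℝ) : E :=
  R + ∫ s in t..τ, x s • D s

@[simp] lemma weightedTail_right (R : E) (D : ℝ → E) : weightedTail x τ R D τ = R := by
  simp [weightedTail]

namespace IsDistributionPath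

lemma intervalIntegrable_smul (hx : IsDistributionPath m x) {f : ℝ → E} {a b : ℝ} (ha : 0 ≤ a)
    (hb : b ≤ m) (hab : a ≤ b) (hf : IntervalIntegrable f volume a b) :
    IntervalIntegrable (fun t => x t • f t) volume a b := by
  have hsub : Icc a b ⊆ Icc (0 : ℝ) m := Icc_subset_Icc ha hb
  have hxint : IntervalIntegrable x volume a b :=
    MonotoneOn.intervalIntegrable (hx.mono.mono (by rwa [uIcc_of_le hab]))
  rw [intervalIntegrable_iff_integrableOn_Ioc_of_le hab] at hf hxint ⊢
  refine Integrable.bdd_smul hf 1 hxint.aestronglyMeasurable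
    ((ae_restrict_iff' measurableSet_Ioc).2 (ae_of_all _ fun t ht => ?_))
  have hxt := hx.mem t (hsub (Ioc_subset_Icc_self ht))
  rw [Real.norm_eq_abs, abs_of_nonneg hxt.1]
  exact hxt.2

variable [CompleteSpace E] {f f' : ℝ → E}

lemma isLipschitzPrimitiveOn_weightedTail (hx : IsDistributionPath m x) (hτ : τ ∈ Icc (0 : ℝ) m)
    (hf : IsLipschitzPrimitiveOn f f' 0 τ) (R : E) :
    IsLipschitzPrimitiveOn (weightedTail x τ R f') (fun t => -(x t • f' t)) 0 τ := by
  obtain ⟨C, hC⟩ := hf.exists_norm_deriv_le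
  have hbound : ∀ᵐ t, t ∈ Ioo 0 τ → ‖x t • f' t‖ ≤ C := by
    filter_upwards [hC] with t ht hmem
    have hxt := hx.mem t ⟨hmem.1.le, hmem.2.le.trans hτ.2⟩
    rw [norm_smul, Real.norm_eq_abs, abs_of_nonneg hxt.1]
    exact (mul_le_of_le_one_left (norm_nonneg _) hxt.2).trans (ht hmem)
  refine (((IsLipschitzPrimitiveOn.const R 0 τ).sub (.of_integral
    (hx.intervalIntegrable_smul le_rfl hτ.2 hτ.1 (hf.intervalIntegrable hτ.1)) hbound
    (right_mem_Icc.2 hτ.1))).congr fun t _ => ?_).congr_deriv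
    (ae_of_all _ fun t _ => zero_sub _)
  rw [weightedTail, intervalIntegral.integral_symm t τ, sub_neg_eq_add]

lemma weightedTail_add_smul (hx : IsDistributionPath m x) (hτ : τ ∈ Icc (0 : ℝ) m) {g g' : ℝ → E}
    (hf : IsLipschitzPrimitiveOn f f' 0 τ) (hg : IsLipschitzPrimitiveOn g g' 0 τ) (R S : E)
    (ε : ℝ) {t : ℝ} (ht : t ∈ Icc 0 τ) :
    weightedTail x τ (R + ε • S) (fun s => f' s + ε • g' s) t =
      weightedTail x τ R f' t + ε • weightedTail x τ S g' t := by
  have hintegrable : ∀ {k k' : ℝ → E}, IsLipschitzPrimitiveOn k k' 0 τ →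
      IntervalIntegrable (fun s => x s • k' s) volume t τ := fun hk =>
    hx.intervalIntegrable_smul ht.1 hτ.2 ht.2 ((hk.mono ht.1 le_rfl).intervalIntegrable ht.2)
  have hg' : IntervalIntegrable (fun s => ε • x s • g' s) volume t τ := (hintegrable hg).smul ε
  simp only [weightedTail, smul_add, smul_comm (x _) ε]
  rw [intervalIntegral.integral_add (hintegrable hf) hg', intervalIntegral.integral_smul]
  abel

lemma posDef_weightedTail (hx : IsDistributionPath m x) (hτ : τ ≤ m) {n : Type*} [Fintype n]
    [DecidableEq n] {R : Matrix n n ℝ} {D : ℝ → Matrix n n ℝ} (hR : R.PosDef)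
    (hD : ∀ᵐ t, t ∈ Ioo 0 τ → (D t).PosSemidef) {t : ℝ} (ht : t ∈ Icc 0 τ) :
    (weightedTail x τ R D t).PosDef := by
  refine hR.add_posSemidef ?_
  rw [intervalIntegral.integral_of_le ht.2]
  refine posSemidef_integral ((ae_restrict_iff' measurableSet_Ioc).2 ?_)
  filter_upwards [hD, Measure.ae_ne volume τ] with s hs hsτ hmem
  have hs0 : 0 < s := ht.1.trans_lt hmem.1
  exact (hs ⟨hs0, lt_of_le_of_ne hmem.2 hsτ⟩).smul (hx.mem s ⟨hs0.le, hmem.2.trans hτ⟩).1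

end IsDistributionPath

end WeightedTail

section Paths

variable {m : ℕ} {Q A : Matrix (Fin m) (Fin m) ℝ} {x : ℝ → ℝ}
  {Φ : ℝ → Matrix (Fin m) (Fin m) ℝ} {τ : ℝ}

lemma pathDeriv_eq_of_hasDerivAt {t : ℝ} (h : HasDerivAt Φ A t) : pathDeriv Φ t = A := by
  ext i j
  exact ((Matrix.entryLinearMap ℝ ℝ i j).toContinuousLinearMap.hasFDerivAt.comp_hasDerivAt t
    h).deriv

lemma exists_norm_le_mul_sqrt_frob (m : ℕ) :
    ∃ K : ℝ≥0, ∀ A : Matrix (Fin m) (Fin m) ℝ, ‖A‖ ≤ K * √(frob A A) := by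
  refine ⟨∑ i : Fin m, ∑ j : Fin m, ‖(Matrix.single i j (1 : ℝ) : Matrix (Fin m) (Fin m) ℝ)‖₊,
    fun A => ?_⟩
  have hentry : ∀ i j, |A i j| ≤ √(frob A A) := fun i j => by
    rw [← Real.sqrt_sq_eq_abs, sq]
    refine Real.sqrt_le_sqrt ?_
    calc A i j * A i j ≤ ∑ j, A i j * A i j :=
          Finset.single_le_sum (f := fun j => A i j * A i j) (fun j _ => mul_self_nonneg _)
            (Finset.mem_univ j)
      _ ≤ frob A A := Finset.single_le_sum (f := fun i => ∑ j, A i j * A i j)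
            (fun i _ => Finset.sum_nonneg fun j _ => mul_self_nonneg _) (Finset.mem_univ i)
  calc ‖A‖ = ‖∑ i, ∑ j, A i j • Matrix.single i j (1 : ℝ)‖ := by
        simp only [Matrix.smul_single, smul_eq_mul, mul_one]
        rw [← Matrix.matrix_eq_sum_single A]
    _ ≤ ∑ i, ∑ j, ‖Matrix.single i j (1 : ℝ)‖ * √(frob A A) :=
        norm_sum_le_of_le _ fun i _ => norm_sum_le_of_le _ fun j _ => by
          rw [norm_smul, mul_comm]
          exact mul_le_mul_of_nonneg_left (hentry i j) (norm_nonneg _)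
    _ = _ := by
          push_cast
          simp only [Finset.sum_mul]

namespace IsMatrixPath

lemma isLipschitzPrimitiveOn (hΦ : IsMatrixPath Q Φ) :
    IsLipschitzPrimitiveOn Φ (pathDeriv Φ) 0 m := by
  obtain ⟨K, hK⟩ := exists_norm_le_mul_sqrt_frob m
  have hlip : LipschitzOnWith K Φ (Icc (0 : ℝ) m) := .of_dist_le_mul fun s hs t ht => by
    rw [dist_eq_norm, Real.dist_eq]
    exact (hK _).trans (mul_le_mul_of_nonneg_left (hΦ.lipschitz t ht s hs) K.2)
  refine ⟨⟨K, hlip⟩, ?_⟩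
  filter_upwards [hlip.ae_differentiableWithinAt_of_mem_real] with t ht hmem
  have hderiv := ((ht (Ioo_subset_Icc_self hmem)).differentiableAt
    (Icc_mem_nhds hmem.1 hmem.2)).hasDerivAt
  rwa [pathDeriv_eq_of_hasDerivAt hderiv]

lemma posSemidef_pathDeriv (hΦ : IsMatrixPath Q Φ) :
    ∀ᵐ t, t ∈ Ioo (0 : ℝ) m → (pathDeriv Φ t).PosSemidef := by
  filter_upwards [hΦ.isLipschitzPrimitiveOn.deriv] with t ht hmem
  refine posSemidef_of_hasDerivAt (ht hmem) ?_
  filter_upwards [Ioo_mem_nhdsGT hmem.2] with s hs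
  exact hΦ.mono t (Ioo_subset_Icc_self hmem) s ⟨hmem.1.le.trans hs.1.le, hs.2.le⟩ hs.1.le

lemma posSemidef_sub (hΦ : IsMatrixPath Q Φ) {t : ℝ} (ht : t ∈ Icc (0 : ℝ) m) :
    (Q - Φ t).PosSemidef := by
  rw [← hΦ.right_end]
  exact hΦ.mono t ht m (right_mem_Icc.2 (Nat.cast_nonneg m)) ht.2

lemma abs_entry_le_one (hΦ : IsMatrixPath Q Φ) (hQ : ∀ i, Q i i = 1) {t : ℝ}
    (ht : t ∈ Icc (0 : ℝ) m) (i j : Fin m) : |Φ t i j| ≤ 1 :=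
  abs_entry_le_one_of_posSemidef_sub (hΦ.posSemidef t ht) (hΦ.posSemidef_sub ht) hQ i j

lemma of_mono_of_trace (hmono : ∀ s ∈ Icc (0 : ℝ) m, ∀ t ∈ Icc (0 : ℝ) m, s ≤ t →
    (Φ t - Φ s).PosSemidef) (htrace : ∀ t ∈ Icc (0 : ℝ) m, (Φ t).trace = t) (hleft : Φ 0 = 0)
    (hright : Φ m = Q) : IsMatrixPath Q Φ := by
  have hlip : ∀ s ∈ Icc (0 : ℝ) m, ∀ t ∈ Icc (0 : ℝ) m, s ≤ t →
      √(frob (Φ t - Φ s) (Φ t - Φ s)) ≤ |t - s| := fun s hs t ht hst => by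
    refine (sqrt_frob_self_le_trace (hmono s hs t ht hst)).trans ?_
    rw [Matrix.trace_sub, htrace s hs, htrace t ht]
    exact le_abs_self _
  refine ⟨fun t ht => ?_, hmono, fun s hs t ht => ?_, htrace, hleft, hright⟩
  · simpa only [hleft, sub_zero] using
      hmono 0 (left_mem_Icc.2 (Nat.cast_nonneg m)) t ht ht.1
  · rcases le_total s t with hst | hts
    · exact hlip s hs t ht hst
    · have hsymm : frob (Φ t - Φ s) (Φ t - Φ s) = frob (Φ s - Φ t) (Φ s - Φ t) := by
        simp only [frob, Matrix.sub_apply, ← sq, sub_sq_comm]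
      rw [hsymm, abs_sub_comm]
      exact hlip t ht s hs hts

end IsMatrixPath

lemma topTime_nonneg : 0 ≤ topTime m x := Real.sInf_nonneg fun _ ht => ht.1.1

lemma IsDistributionPath.eq_one_of_topTime_lt (hx : IsDistributionPath m x) {t : ℝ}
    (ht : topTime m x < t) (htm : t ≤ m) : x t = 1 := by
  have hnonempty : {t | t ∈ Icc (0 : ℝ) m ∧ x t = 1}.Nonempty :=
    ⟨m, right_mem_Icc.2 (Nat.cast_nonneg m), hx.right_end⟩
  obtain ⟨s, ⟨hs, hxs⟩, hst⟩ := exists_lt_of_csInf_lt hnonempty ht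
  have ht' : t ∈ Icc (0 : ℝ) m := ⟨hs.1.trans hst.le, htm⟩
  exact le_antisymm (hx.mem t ht').2 (hxs ▸ hx.mono hs ht' hst.le)

lemma IsAdmissible.exists_isCutoff (hadm : IsAdmissible Q x Φ) : ∃ τ, IsCutoff Q x Φ τ := by
  have hcont : ContinuousWithinAt (fun t => (Q - Φ t).det) (Ioo (topTime m x) m)
      (topTime m x) :=
    ((continuous_const.sub continuous_id).matrix_det.continuousAt.comp_continuousWithinAt
      (hadm.path.isLipschitzPrimitiveOn.continuousOn _
        ⟨topTime_nonneg, hadm.topTime_lt.le⟩)).mono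
      fun t ht => ⟨topTime_nonneg.trans ht.1.le, ht.2.le⟩
  rw [ContinuousWithinAt, nhdsWithin_Ioo_eq_nhdsGT hadm.topTime_lt] at hcont
  obtain ⟨τ, hdet, htop, hm⟩ := ((hcont.eventually (lt_mem_nhds hadm.det_pos)).and
    (Ioo_mem_nhdsGT hadm.topTime_lt)).exists
  exact ⟨τ, htop, hm, hdet⟩

end Paths

section Truncation

variable {m : ℕ} {Q : Matrix (Fin m) (Fin m) ℝ} {x : ℝ → ℝ}
  {Φ : ℝ → Matrix (Fin m) (Fin m) ℝ} {τ : ℝ}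

/-- An admissible pair together with a truncation point, the data at which the Crisanti–Sommers
functional is evaluated. -/
structure IsTruncated (Q : Matrix (Fin m) (Fin m) ℝ) (x : ℝ → ℝ)
    (Φ : ℝ → Matrix (Fin m) (Fin m) ℝ) (τ : ℝ) : Prop extends IsAdmissible Q x Φ where
  cutoff : IsCutoff Q x Φ τ

namespace IsTruncated

lemma of_posDef (hx : IsDistributionPath m x) (hΦ : IsMatrixPath Q Φ) {s : ℝ}
    (hs : s ∈ Icc (0 : ℝ) m) (hxs : x s = 1) (hsτ : s < τ) (hτ : τ < m)
    (hpos : (Q - Φ τ).PosDef) : IsTruncated Q x Φ τ := by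
  have htop_le : topTime m x ≤ s := csInf_le ⟨0, fun _ ht => ht.1.1⟩ ⟨hs, hxs⟩
  have htop : topTime m x < τ := htop_le.trans_lt hsτ
  refine ⟨⟨hx, hΦ, htop.trans hτ, Matrix.PosDef.det_pos ?_⟩, htop, hτ, hpos.det_pos⟩
  rw [← sub_add_sub_cancel Q (Φ τ)]
  exact hpos.add_posSemidef (hΦ.mono _ ⟨topTime_nonneg, (htop.trans hτ).le⟩ _
    ⟨hs.1.trans hsτ.le, hτ.le⟩ htop.le)

variable (hT : IsTruncated Q x Φ τ)

include hT

lemma nonneg : 0 ≤ τ := topTime_nonneg.trans hT.cutoff.1.le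

lemma lt : τ < m := hT.cutoff.2.1

lemma mem_Icc : τ ∈ Icc (0 : ℝ) m := ⟨hT.nonneg, hT.lt.le⟩

lemma eq_one_of_le {t : ℝ} (ht : τ ≤ t) (htm : t ≤ m) : x t = 1 :=
  hT.distr.eq_one_of_topTime_lt (hT.cutoff.1.trans_le ht) htm

lemma posDef : (Q - Φ τ).PosDef :=
  (hT.path.posSemidef_sub hT.mem_Icc).posDef_iff_det_ne_zero.2 hT.cutoff.2.2.ne'

lemma isLipschitzPrimitiveOn : IsLipschitzPrimitiveOn Φ (pathDeriv Φ) 0 τ :=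
  hT.path.isLipschitzPrimitiveOn.mono le_rfl hT.lt.le

lemma posSemidef_pathDeriv : ∀ᵐ t, t ∈ Ioo 0 τ → (pathDeriv Φ t).PosSemidef := by
  filter_upwards [hT.path.posSemidef_pathDeriv] with t ht hmem
  exact ht (Ioo_subset_Ioo_right hT.lt.le hmem)

lemma pathHat_eq_weightedTail {t : ℝ} (ht : t ∈ Icc 0 τ) :
    pathHat x Φ t = weightedTail x τ (Q - Φ τ) (pathDeriv Φ) t := by
  have hintegrable : ∀ {a b : ℝ}, 0 ≤ a → a ≤ b → b ≤ m →
      IntervalIntegrable (fun s => x s • pathDeriv Φ s) volume a b := fun ha hab hb =>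
    hT.distr.intervalIntegrable_smul ha hb hab
      ((hT.path.isLipschitzPrimitiveOn.mono ha hb).intervalIntegrable hab)
  have hhat : pathHat x Φ t = ∫ s in t..(m : ℝ), x s • pathDeriv Φ s := by
    ext i j
    exact (Matrix.entryLinearMap ℝ ℝ i j).toContinuousLinearMap.intervalIntegral_comp_comm
      (hintegrable ht.1 (ht.2.trans hT.lt.le) le_rfl)
  have htop : ∫ s in τ..(m : ℝ), x s • pathDeriv Φ s = Q - Φ τ := by
    rw [← hT.path.right_end,
      ← (hT.path.isLipschitzPrimitiveOn.mono hT.nonneg le_rfl).integral_eq_sub hT.lt.le]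
    refine intervalIntegral.integral_congr fun s hs => ?_
    rw [uIcc_of_le hT.lt.le] at hs
    simp only [hT.eq_one_of_le hs.1 hs.2, one_smul]
  rw [hhat, weightedTail, ← htop, add_comm, intervalIntegral.integral_add_adjacent_intervals
    (hintegrable ht.1 ht.2 hT.lt.le) (hintegrable hT.nonneg hT.lt.le le_rfl)]

lemma posDef_pathHat {t : ℝ} (ht : t ∈ Icc 0 τ) : (pathHat x Φ t).PosDef := by
  rw [hT.pathHat_eq_weightedTail ht]
  exact hT.distr.posDef_weightedTail hT.lt.le hT.posDef hT.posSemidef_pathDeriv ht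

lemma isLipschitzPrimitiveOn_pathHat :
    IsLipschitzPrimitiveOn (pathHat x Φ) (fun t => -(x t • pathDeriv Φ t)) 0 τ :=
  (hT.distr.isLipschitzPrimitiveOn_weightedTail hT.mem_Icc hT.isLipschitzPrimitiveOn _).congr
    fun _ ht => (hT.pathHat_eq_weightedTail ht).symm

lemma isLipschitzPrimitiveOn_pathHat_inv : IsLipschitzPrimitiveOn (fun t => (pathHat x Φ t)⁻¹)
    (fun t => x t • ((pathHat x Φ t)⁻¹ * pathDeriv Φ t * (pathHat x Φ t)⁻¹)) 0 τ :=
  (hT.isLipschitzPrimitiveOn_pathHat.matrixInv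
    fun _ ht => (hT.posDef_pathHat ht).isUnit).congr_deriv (ae_of_all _ fun t _ => by
      simp only [mul_neg, neg_mul, neg_neg, Matrix.mul_smul, Matrix.smul_mul])

end IsTruncated

end Truncation

section Energy

/-- The Crisanti–Sommers functional, without the factor `1 / 2`, as a function of a matrix curve
`Λ` on `[0, τ]` with derivative `Λ'`. The curve need not be parametrized by its trace nor start at
`0`: a jump to `Λ 0` at time `0` enters only through `⟨Λ̂(0)⁻¹, Λ 0⟩`. -/
def curveFunctional {m : ℕ} (β : ℕ → Fin m → ℝ) (h : Fin m → ℝ)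
    (Q : Matrix (Fin m) (Fin m) ℝ) (x : ℝ → ℝ) (τ : ℝ) (Λ Λ' : ℝ → Matrix (Fin m) (Fin m) ℝ) : ℝ :=
  (∫ t in (0 : ℝ)..τ, x t * frob (xiPrime β (Λ t) + Matrix.vecMulVec h h) (Λ' t))
    + (xiTotal β h Q - xiTotal β h (Λ τ)) + Real.log (Q - Λ τ).det
    + frob (weightedTail x τ (Q - Λ τ) Λ' 0)⁻¹ (Λ 0)
    + ∫ t in (0 : ℝ)..τ, frob (weightedTail x τ (Q - Λ τ) Λ' t)⁻¹ (Λ' t)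

variable {m : ℕ} {β : ℕ → Fin m → ℝ} {Q : Matrix (Fin m) (Fin m) ℝ} {x : ℝ → ℝ}
  {Φ : ℝ → Matrix (Fin m) (Fin m) ℝ} {τ a b : ℝ}
  (hβ : ∀ j, Summable fun p : ℕ => (2 : ℝ) ^ p * β p j ^ 2) (h : Fin m → ℝ)

include hβ

lemma IsLipschitzPrimitiveOn.xiTotal {X X' : ℝ → Matrix (Fin m) (Fin m) ℝ}
    (hX : IsLipschitzPrimitiveOn X X' a b) (hX2 : ∀ t ∈ Icc a b, ∀ i j, |X t i j| < 8 / 5) :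
    IsLipschitzPrimitiveOn (fun t => xiTotal β h (X t))
      (fun t => frob (xiPrime β (X t) + Matrix.vecMulVec h h) (X' t)) a b := by
  refine (hX.contDiffAt_comp fun t ht => contDiffAt_xiTotal hβ h (hX2 t ht)).congr_deriv
    (ae_of_all _ fun t ht => ?_)
  rw [(hasFDerivAt_xiTotal hβ h (hX2 t (Ioo_subset_Icc_self ht))).fderiv, frobCLM_apply]

lemma IsTruncated.two_mul_crisantiSommers (hT : IsTruncated Q x Φ τ) (hQ : ∀ i, Q i i = 1) :
    2 * crisantiSommers β h x Φ τ =
      (∫ t in (0 : ℝ)..τ, x t * frob (xiPrime β (Φ t) + Matrix.vecMulVec h h) (pathDeriv Φ t))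
      + (xiTotal β h Q - xiTotal β h (Φ τ)) + Real.log (Q - Φ τ).det
      + ∫ t in (0 : ℝ)..τ, frob (pathHat x Φ t)⁻¹ (pathDeriv Φ t) := by
  have henergy := hT.path.isLipschitzPrimitiveOn.xiTotal hβ h
    fun t ht i j => (hT.path.abs_entry_le_one hQ ht i j).trans_lt (by norm_num)
  have hintegrable : ∀ {a b : ℝ}, 0 ≤ a → a ≤ b → b ≤ m → IntervalIntegrable
      (fun t => x t * frob (xiPrime β (Φ t) + Matrix.vecMulVec h h) (pathDeriv Φ t))
      volume a b := fun ha hab hb =>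
    hT.distr.intervalIntegrable_smul ha hb hab ((henergy.mono ha hb).intervalIntegrable hab)
  have htop : (∫ t in τ..(m : ℝ), x t *
      frob (xiPrime β (Φ t) + Matrix.vecMulVec h h) (pathDeriv Φ t)) =
      xiTotal β h Q - xiTotal β h (Φ τ) := by
    rw [← hT.path.right_end, ← (henergy.mono hT.nonneg le_rfl).integral_eq_sub hT.lt.le]
    refine intervalIntegral.integral_congr fun s hs => ?_
    rw [uIcc_of_le hT.lt.le] at hs
    simp only [hT.eq_one_of_le hs.1 hs.2, one_mul]
  rw [crisantiSommers, hT.path.right_end, ← intervalIntegral.integral_add_adjacent_intervals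
    (hintegrable le_rfl hT.nonneg hT.lt.le) (hintegrable hT.nonneg hT.lt.le le_rfl), htop]
  ring

lemma IsTruncated.curveFunctional_eq (hT : IsTruncated Q x Φ τ) (hQ : ∀ i, Q i i = 1) :
    curveFunctional β h Q x τ Φ (pathDeriv Φ) = 2 * crisantiSommers β h x Φ τ := by
  have hhat : (∫ t in (0 : ℝ)..τ, frob (pathHat x Φ t)⁻¹ (pathDeriv Φ t)) =
      ∫ t in (0 : ℝ)..τ, frob (weightedTail x τ (Q - Φ τ) (pathDeriv Φ) t)⁻¹ (pathDeriv Φ t) :=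
    intervalIntegral.integral_congr fun t ht => by
      rw [uIcc_of_le hT.nonneg] at ht
      simp only [hT.pathHat_eq_weightedTail ht]
  rw [hT.two_mul_crisantiSommers hβ h hQ, hhat, curveFunctional, hT.path.left_end,
    ← frobCLM_apply _ 0, map_zero, add_zero]

end Energy

section ParisiMeasure

variable {E : Type*} [NormedAddCommGroup E] [NormedSpace ℝ E] {m : ℕ} {x : ℝ → ℝ}
  {μ : Measure ℝ}

namespace IsParisiMeasure

lemma isProbabilityMeasure (hμ : IsParisiMeasure m x μ) (hx : x m = 1) :
    IsProbabilityMeasure μ := by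
  refine ⟨?_⟩
  rw [← measure_add_measure_compl (measurableSet_Icc : MeasurableSet (Icc (0 : ℝ) m)), hμ.1,
    hμ.2 m (right_mem_Icc.2 (Nat.cast_nonneg m)), hx, ENNReal.ofReal_one, add_zero]

lemma real_Icc_zero (hμ : IsParisiMeasure m x μ) (hx : IsDistributionPath m x) {t : ℝ}
    (ht : t ∈ Icc (0 : ℝ) m) : μ.real (Icc 0 t) = x t := by
  rw [Measure.real, hμ.2 t ht, ENNReal.toReal_ofReal (hx.mem t ht).1]

lemma real_Icc_of_singleton_eq_zero (hμ : IsParisiMeasure m x μ) (hx : IsDistributionPath m x)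
    {q τ : ℝ} (hq : q ∈ Icc 0 τ) (hτ : τ ≤ m) (hatom : μ {q} = 0) :
    μ.real (Icc q τ) = x τ - x q := by
  have := hμ.isProbabilityMeasure hx.right_end
  have hdisj : Disjoint (Icc 0 q) (Ioc q τ) :=
    Set.disjoint_left.2 fun s hs hs' => hs'.1.not_ge hs.2
  rw [← hμ.real_Icc_zero hx ⟨hq.1.trans hq.2, hτ⟩, ← hμ.real_Icc_zero hx ⟨hq.1, hq.2.trans hτ⟩,
    ← Icc_union_Ioc_eq_Icc hq.1 hq.2, measureReal_union hdisj measurableSet_Ioc,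
    add_sub_cancel_left, ← Icc_sdiff_left, measureReal_def, measureReal_def,
    measure_sdiff_null hatom]

lemma setIntegral_eq [CompleteSpace E] (hμ : IsParisiMeasure m x μ)
    (hx : IsDistributionPath m x) {τ : ℝ} (hτ : τ ∈ Icc (0 : ℝ) m) {f f' : ℝ → E}
    (hf : IsLipschitzPrimitiveOn f f' 0 τ) :
    ∫ t in Icc 0 τ, f t ∂μ = x τ • f τ - ∫ t in (0 : ℝ)..τ, x t • f' t := by
  have := hμ.isProbabilityMeasure hx.right_end
  have hatom : ∀ᵐ q : ℝ, μ {q} = 0 := by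
    filter_upwards [(Measure.countable_meas_level_set_pos (μ := μ)
      (measurable_id (α := ℝ))).ae_notMem volume] with q hq
    simpa only [mem_ofPred_eq, not_lt, nonpos_iff_eq_zero, id_eq,
      ofPred_eq_eq_singleton] using hq
  have hfubini := hf.setIntegral_bilinear (ContinuousLinearMap.lsmul ℝ ℝ) hτ.1 (μ := μ)
    (integrable_const (1 : ℝ))
  have htail : ∫ q in (0 : ℝ)..τ, μ.real (Icc q τ) • f' q =
      x τ • (f τ - f 0) - ∫ q in (0 : ℝ)..τ, x q • f' q := by
    have hint := hf.intervalIntegrable hτ.1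
    have hint_const : IntervalIntegrable (fun q => x τ • f' q) volume 0 τ := hint.smul (x τ)
    rw [← hf.integral_eq_sub hτ.1, ← intervalIntegral.integral_smul,
      ← intervalIntegral.integral_sub hint_const
        (hx.intervalIntegrable_smul le_rfl hτ.2 hτ.1 hint)]
    refine intervalIntegral.integral_congr_ae ?_
    filter_upwards [hatom] with q hq hmem
    rw [uIoc_of_le hτ.1] at hmem
    rw [hμ.real_Icc_of_singleton_eq_zero hx (Ioc_subset_Icc_self hmem) hτ.2 hq, sub_smul]
  simp only [ContinuousLinearMap.lsmul_apply, setIntegral_const, smul_eq_mul, mul_one,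
    one_smul, htail, hμ.real_Icc_zero hx hτ] at hfubini
  rw [hfubini, smul_sub]
  abel

end IsParisiMeasure

end ParisiMeasure

section ChangeOfVariables

variable {E : Type*} [NormedAddCommGroup E] [NormedSpace ℝ E] {σ : ℝ ≃o ℝ} {σ' : ℝ → ℝ}

lemma intervalIntegral_orderIso (hσ : ∀ t, HasDerivAt σ (σ' t) t) (hσ' : ∀ t, 0 < σ' t) {a b : ℝ}
    (hab : a ≤ b) (g : ℝ → E) : ∫ u in σ a..σ b, g u = ∫ q in a..b, σ' q • g (σ q) := by
  rw [intervalIntegral.integral_of_le (σ.monotone hab), intervalIntegral.integral_of_le hab,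
    ← σ.image_Ioc, integral_image_eq_integral_abs_deriv_smul measurableSet_Ioc
      (fun t _ => (hσ t).hasDerivWithinAt) σ.injective.injOn]
  simp only [abs_of_pos (hσ' _)]

lemma hasDerivAt_orderIso_symm (hσ : ∀ t, HasDerivAt σ (σ' t) t) (hσ' : ∀ t, 0 < σ' t) (q : ℝ) :
    HasDerivAt σ.symm (σ' q)⁻¹ (σ q) :=
  HasDerivAt.of_local_left_inverse σ.symm.continuous.continuousAt
    ((σ.symm_apply_apply q).symm ▸ hσ q) (hσ' q).ne'
    (Eventually.of_forall σ.apply_symm_apply)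

end ChangeOfVariables

section TraceParametrization

variable {m : ℕ} {Q : Matrix (Fin m) (Fin m) ℝ} {x : ℝ → ℝ} {τ : ℝ}
  {Λ Λ' : ℝ → Matrix (Fin m) (Fin m) ℝ} {σ : ℝ ≃o ℝ} {σ' : ℝ → ℝ}

/-- Nondecreasing matrix curves on `[0, τ]` strictly below `Q`, with derivative `Λ'` and trace `σ`.
Unlike the paths of `IsMatrixPath` they start with a jump of trace `σ 0 > 0`, into which a path
with no mass at `0` can be squeezed. -/
structure IsMonotoneCurve (Q : Matrix (Fin m) (Fin m) ℝ) (τ : ℝ)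
    (Λ Λ' : ℝ → Matrix (Fin m) (Fin m) ℝ) (σ : ℝ ≃o ℝ) (σ' : ℝ → ℝ) : Prop where
  nonneg : 0 ≤ τ
  lipschitz : IsLipschitzPrimitiveOn Λ Λ' 0 τ
  mono : ∀ s ∈ Icc 0 τ, ∀ t ∈ Icc 0 τ, s ≤ t → (Λ t - Λ s).PosSemidef
  posSemidef_left : (Λ 0).PosSemidef
  posDef_right : (Q - Λ τ).PosDef
  trace_eq : ∀ t ∈ Icc 0 τ, (Λ t).trace = σ t
  hasDerivAt : ∀ t, HasDerivAt σ (σ' t) t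
  deriv_pos : ∀ t, 0 < σ' t
  trace_left_pos : 0 < σ 0

/-- The inverse of the trace `σ` on `[σ 0, σ τ]`, extended by constants. -/
def traceInv (σ : ℝ ≃o ℝ) (τ t : ℝ) : ℝ := σ.symm (max (σ 0) (min t (σ τ)))

/-- The curve `Λ` parametrized by its trace, joined to `0` and to `Q` by segments. -/
def tracePath (Q : Matrix (Fin m) (Fin m) ℝ) (τ : ℝ) (Λ : ℝ → Matrix (Fin m) (Fin m) ℝ)
    (σ : ℝ ≃o ℝ) (t : ℝ) : Matrix (Fin m) (Fin m) ℝ :=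
  min 1 (t / σ 0) • Λ 0 + (Λ (traceInv σ τ t) - Λ 0)
    + max 0 ((t - σ τ) / (m - σ τ)) • (Q - Λ τ)

/-- The distribution function `x` transported along the trace `σ`, with no mass on the initial
segment of `tracePath`. -/
def traceDistr (x : ℝ → ℝ) (τ : ℝ) (σ : ℝ ≃o ℝ) (t : ℝ) : ℝ :=
  if t < σ 0 then 0 else x (traceInv σ τ t)

lemma traceInv_mono : Monotone (traceInv σ τ) := fun _ _ hst =>
  σ.symm.monotone (max_le_max le_rfl (min_le_min_right _ hst))

lemma continuous_traceInv : Continuous (traceInv σ τ) :=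
  σ.symm.continuous.comp (by fun_prop)

lemma traceInv_mem (hτ : 0 ≤ τ) (t : ℝ) : traceInv σ τ t ∈ Icc 0 τ := by
  have hστ := σ.monotone hτ
  constructor
  · rw [traceInv, σ.le_symm_apply]
    exact le_max_left _ _
  · rw [traceInv, σ.symm_apply_le]
    exact max_le hστ (min_le_right _ _)

lemma traceInv_apply {q : ℝ} (hq : q ∈ Icc 0 τ) : traceInv σ τ (σ q) = q := by
  rw [traceInv, min_eq_left (σ.monotone hq.2), max_eq_right (σ.monotone hq.1),
    σ.symm_apply_apply]

lemma traceInv_of_le {t : ℝ} (ht : t ≤ σ 0) : traceInv σ τ t = 0 := by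
  rw [traceInv, max_eq_left (min_le_of_left_le ht), σ.symm_apply_apply]

lemma traceInv_of_ge (hτ : 0 ≤ τ) {t : ℝ} (ht : σ τ ≤ t) : traceInv σ τ t = τ := by
  rw [traceInv, min_eq_right ht, max_eq_right (σ.monotone hτ), σ.symm_apply_apply]

lemma traceDistr_of_lt {t : ℝ} (ht : t < σ 0) : traceDistr x τ σ t = 0 := if_pos ht

lemma traceDistr_of_ge {t : ℝ} (ht : σ 0 ≤ t) : traceDistr x τ σ t = x (traceInv σ τ t) :=
  if_neg ht.not_gt

lemma isDistributionPath_traceDistr (hx : IsDistributionPath m x) (hτ : 0 ≤ τ) (hτm : τ < m)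
    (hxτ : x τ = 1) (hστ : σ τ ≤ m) : IsDistributionPath m (traceDistr x τ σ) := by
  have hmem : ∀ t, traceInv σ τ t ∈ Icc (0 : ℝ) m := fun t =>
    Icc_subset_Icc_right hτm.le (traceInv_mem hτ t)
  have hnonneg : ∀ t, traceDistr x τ σ t ∈ Icc (0 : ℝ) 1 := fun t => by
    rcases lt_or_ge t (σ 0) with ht | ht
    · rw [traceDistr_of_lt ht]
      exact ⟨le_rfl, zero_le_one⟩
    · rw [traceDistr_of_ge ht]
      exact hx.mem _ (hmem t)
  refine ⟨fun t _ => hnonneg t, fun s _ t _ hst => ?_, fun t _ => ?_, ?_⟩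
  · rcases lt_or_ge s (σ 0) with hs | hs
    · rw [traceDistr_of_lt hs]
      exact (hnonneg t).1
    · rw [traceDistr_of_ge hs, traceDistr_of_ge (hs.trans hst)]
      exact hx.mono (hmem s) (hmem t) (traceInv_mono hst)
  · rcases lt_or_ge t (σ 0) with ht | ht
    · refine ContinuousAt.continuousWithinAt (continuousAt_const.congr (f := fun _ => 0) ?_)
      filter_upwards [Iio_mem_nhds ht] with s hs using (traceDistr_of_lt hs).symm
    · have hcomp : ContinuousWithinAt (x ∘ traceInv σ τ) (Ici t) t :=
        (hx.rightCont _ ⟨(hmem t).1, (traceInv_mem hτ t).2.trans_lt hτm⟩).comp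
          continuous_traceInv.continuousWithinAt fun s hs => traceInv_mono hs
      exact hcomp.congr (fun s hs => traceDistr_of_ge (ht.trans hs)) (traceDistr_of_ge ht)
  · rw [traceDistr_of_ge ((σ.monotone hτ).trans hστ), traceInv_of_ge hτ hστ, hxτ]

namespace IsMonotoneCurve

variable (hΛ : IsMonotoneCurve Q τ Λ Λ' σ σ')

include hΛ

lemma trace_right_lt (hm : 0 < m) (hQ : Q.trace = m) : σ τ < m := by
  have : Nonempty (Fin m) := ⟨⟨0, hm⟩⟩
  have htrace := hΛ.posDef_right.trace_pos
  rwa [Matrix.trace_sub, hQ, hΛ.trace_eq τ (right_mem_Icc.2 hΛ.nonneg), sub_pos] at htrace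

lemma trace_left_le_right : σ 0 ≤ σ τ := σ.monotone hΛ.nonneg

lemma trace_tracePath (hQ : Q.trace = m) (hστ : σ τ < m) {t : ℝ} :
    (tracePath Q τ Λ σ t).trace = t := by
  have htrace_left := hΛ.trace_eq 0 (left_mem_Icc.2 hΛ.nonneg)
  have htrace_right := hΛ.trace_eq τ (right_mem_Icc.2 hΛ.nonneg)
  have htrace_time : (Λ (traceInv σ τ t)).trace = max (σ 0) (min t (σ τ)) := by
    rw [hΛ.trace_eq _ (traceInv_mem hΛ.nonneg t), traceInv, σ.apply_symm_apply]
  simp only [tracePath, Matrix.trace_add, Matrix.trace_sub, Matrix.trace_smul, htrace_left,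
    htrace_right, htrace_time, hQ, smul_eq_mul]
  rw [min_mul_of_nonneg _ _ hΛ.trace_left_pos.le, max_mul_of_nonneg _ _ (sub_pos.2 hστ).le,
    div_mul_cancel₀ _ hΛ.trace_left_pos.ne', div_mul_cancel₀ _ (sub_pos.2 hστ).ne']
  have := hΛ.trace_left_le_right
  grind

lemma isMatrixPath_tracePath (hQ : Q.trace = m) (hστ : σ τ < m) :
    IsMatrixPath Q (tracePath Q τ Λ σ) := by
  have hm_sub : 0 < m - σ τ := sub_pos.2 hστ
  have hright := hΛ.trace_left_pos.trans_le hΛ.trace_left_le_right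
  refine .of_mono_of_trace (fun s _ t _ hst => ?_)
    (fun t _ => hΛ.trace_tracePath hQ hστ) ?_ ?_
  · have hsplit : tracePath Q τ Λ σ t - tracePath Q τ Λ σ s =
        (min 1 (t / σ 0) - min 1 (s / σ 0)) • Λ 0 + (Λ (traceInv σ τ t) - Λ (traceInv σ τ s))
          + (max 0 ((t - σ τ) / (m - σ τ)) - max 0 ((s - σ τ) / (m - σ τ))) • (Q - Λ τ) := by
      simp only [tracePath, sub_smul]
      abel
    have hinitial : min 1 (s / σ 0) ≤ min 1 (t / σ 0) :=
      min_le_min_left _ (div_le_div_of_nonneg_right hst hΛ.trace_left_pos.le)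
    have hfinal : max 0 ((s - σ τ) / (m - σ τ)) ≤ max 0 ((t - σ τ) / (m - σ τ)) :=
      max_le_max_left _ (div_le_div_of_nonneg_right (sub_le_sub_right hst _) hm_sub.le)
    rw [hsplit]
    exact ((hΛ.posSemidef_left.smul (sub_nonneg.2 hinitial)).add (hΛ.mono _
      (traceInv_mem hΛ.nonneg s) _ (traceInv_mem hΛ.nonneg t) (traceInv_mono hst))).add
      (hΛ.posDef_right.posSemidef.smul (sub_nonneg.2 hfinal))
  · rw [tracePath, traceInv_of_le hΛ.trace_left_pos.le, zero_div, min_eq_right zero_le_one,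
      max_eq_left (div_nonpos_of_nonpos_of_nonneg (by linarith) hm_sub.le)]
    simp only [zero_smul, sub_self, add_zero]
  · rw [tracePath, traceInv_of_ge hΛ.nonneg hστ.le, div_self hm_sub.ne',
      max_eq_right zero_le_one, min_eq_left
        ((one_le_div₀ hΛ.trace_left_pos).2 (hΛ.trace_left_le_right.trans hστ.le))]
    simp only [one_smul, add_sub_cancel]

lemma tracePath_apply (hστ : σ τ ≤ m) {q : ℝ} (hq : q ∈ Icc 0 τ) :
    tracePath Q τ Λ σ (σ q) = Λ q := by
  have hfinal : (σ q - σ τ) / (m - σ τ) ≤ 0 :=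
    div_nonpos_of_nonpos_of_nonneg (sub_nonpos.2 (σ.monotone hq.2)) (sub_nonneg.2 hστ)
  rw [tracePath, traceInv_apply hq, min_eq_left ((one_le_div₀ hΛ.trace_left_pos).2
    (σ.monotone hq.1)), max_eq_left hfinal, one_smul, zero_smul, add_zero, add_sub_cancel]

lemma isTruncated_trace (hx : IsDistributionPath m x) (hQ : Q.trace = m) (hτm : τ < m) {s : ℝ}
    (hs : s ∈ Ico 0 τ) (hxs : x s = 1) :
    IsTruncated Q (traceDistr x τ σ) (tracePath Q τ Λ σ) (σ τ) := by
  have hm : 0 < m := Nat.cast_pos.1 (hΛ.nonneg.trans_lt hτm)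
  have hστ := hΛ.trace_right_lt hm hQ
  have hxτ : x τ = 1 := le_antisymm (hx.mem τ ⟨hΛ.nonneg, hτm.le⟩).2
    (hxs ▸ hx.mono ⟨hs.1, hs.2.le.trans hτm.le⟩ ⟨hΛ.nonneg, hτm.le⟩ hs.2.le)
  have hσs : σ s < σ τ := σ.strictMono hs.2
  refine .of_posDef (isDistributionPath_traceDistr hx hΛ.nonneg hτm hxτ hστ.le)
    (hΛ.isMatrixPath_tracePath hQ hστ)
    ⟨hΛ.trace_left_pos.le.trans (σ.monotone hs.1), (hσs.trans hστ).le⟩ ?_ hσs hστ ?_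
  · rw [traceDistr_of_ge (σ.monotone hs.1), traceInv_apply (Ico_subset_Icc_self hs), hxs]
  · rw [hΛ.tracePath_apply hστ.le (right_mem_Icc.2 hΛ.nonneg)]
    exact hΛ.posDef_right

lemma pathDeriv_tracePath_initial (hστ : σ τ ≤ m) {t : ℝ} (ht : t < σ 0) :
    pathDeriv (tracePath Q τ Λ σ) t = (σ 0)⁻¹ • Λ 0 := by
  refine pathDeriv_eq_of_hasDerivAt (HasDerivAt.congr_of_eventuallyEq
    (f := fun s => (s / σ 0) • Λ 0) ?_ ?_)
  · simpa only [one_div] using ((hasDerivAt_id' t).div_const (σ 0)).smul_const (Λ 0)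
  · filter_upwards [Iio_mem_nhds ht] with s hs
    have hsτ : s - σ τ ≤ 0 := sub_nonpos.2 (hs.le.trans hΛ.trace_left_le_right)
    rw [tracePath, traceInv_of_le hs.le, min_eq_right ((div_le_one₀ hΛ.trace_left_pos).2 hs.le),
      max_eq_left (div_nonpos_of_nonpos_of_nonneg hsτ (sub_nonneg.2 hστ))]
    simp only [sub_self, add_zero, zero_smul]

lemma pathDeriv_tracePath_apply (hστ : σ τ ≤ m) :
    ∀ᵐ q, q ∈ Ioo 0 τ → pathDeriv (tracePath Q τ Λ σ) (σ q) = (σ' q)⁻¹ • Λ' q := by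
  filter_upwards [hΛ.lipschitz.deriv] with q hq hmem
  have hcomp : HasDerivAt (Λ ∘ σ.symm) ((σ' q)⁻¹ • Λ' q) (σ q) := by
    refine HasDerivAt.scomp (σ q) ?_ (hasDerivAt_orderIso_symm hΛ.hasDerivAt hΛ.deriv_pos q)
    rw [σ.symm_apply_apply]
    exact hq hmem
  refine pathDeriv_eq_of_hasDerivAt (hcomp.congr_of_eventuallyEq ?_)
  filter_upwards [Ioo_mem_nhds (σ.strictMono hmem.1) (σ.strictMono hmem.2)] with u hu
  have hu' : σ.symm u ∈ Icc 0 τ := ⟨(σ.le_symm_apply).2 hu.1.le, (σ.symm_apply_le).2 hu.2.le⟩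
  simpa only [σ.apply_symm_apply, Function.comp_apply] using hΛ.tracePath_apply hστ hu'

lemma intervalIntegral_pathDeriv_tracePath {E : Type*} [NormedAddCommGroup E] [NormedSpace ℝ E]
    (hστ : σ τ ≤ m) (L : ℝ → Matrix (Fin m) (Fin m) ℝ →L[ℝ] E) {a b : ℝ} (ha : 0 ≤ a)
    (hab : a ≤ b) (hb : b ≤ τ) :
    ∫ u in σ a..σ b, L u (pathDeriv (tracePath Q τ Λ σ) u) = ∫ q in a..b, L (σ q) (Λ' q) := by
  rw [intervalIntegral_orderIso hΛ.hasDerivAt hΛ.deriv_pos hab]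
  refine intervalIntegral.integral_congr_ae ?_
  filter_upwards [hΛ.pathDeriv_tracePath_apply hστ, Measure.ae_ne volume τ] with q hq hqτ hmem
  rw [uIoc_of_le hab] at hmem
  rw [hq ⟨ha.trans_lt hmem.1, lt_of_le_of_ne (hmem.2.trans hb) hqτ⟩, map_smul,
    smul_inv_smul₀ (hΛ.deriv_pos q).ne']

section Functional

variable (hT : IsTruncated Q (traceDistr x τ σ) (tracePath Q τ Λ σ) (σ τ))

include hT

lemma pathHat_trace_apply {q : ℝ} (hq : q ∈ Icc 0 τ) :
    pathHat (traceDistr x τ σ) (tracePath Q τ Λ σ) (σ q) =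
      weightedTail x τ (Q - Λ τ) Λ' q := by
  rw [hT.pathHat_eq_weightedTail
      ⟨hΛ.trace_left_pos.le.trans (σ.monotone hq.1), σ.monotone hq.2⟩, weightedTail, weightedTail,
    hΛ.tracePath_apply hT.lt.le (right_mem_Icc.2 hΛ.nonneg)]
  refine congrArg (Q - Λ τ + ·) ((hΛ.intervalIntegral_pathDeriv_tracePath hT.lt.le
    (fun u => traceDistr x τ σ u • ContinuousLinearMap.id ℝ _) hq.1 hq.2 le_rfl).trans
    (intervalIntegral.integral_congr fun s hs => ?_))
  rw [uIcc_of_le hq.2] at hs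
  have hs0 : 0 ≤ s := hq.1.trans hs.1
  simp only [traceDistr_of_ge (σ.monotone hs0), traceInv_apply ⟨hs0, hs.2⟩]
  rfl

lemma pathHat_trace_initial {t : ℝ} (ht : t ∈ Icc 0 (σ 0)) :
    pathHat (traceDistr x τ σ) (tracePath Q τ Λ σ) t = weightedTail x τ (Q - Λ τ) Λ' 0 := by
  rw [← hΛ.pathHat_trace_apply hT (left_mem_Icc.2 hΛ.nonneg), ← sub_eq_zero, ← neg_sub,
    ← (hT.isLipschitzPrimitiveOn_pathHat.mono ht.1 hΛ.trace_left_le_right).integral_eq_sub ht.2,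
    neg_eq_zero]
  refine intervalIntegral.integral_zero_ae ?_
  filter_upwards [Measure.ae_ne volume (σ 0)] with s hs hmem
  rw [uIoc_of_le ht.2] at hmem
  rw [traceDistr_of_lt (lt_of_le_of_ne hmem.2 hs), zero_smul, neg_zero]

lemma integral_inv_pathHat_trace :
    ∫ t in (0 : ℝ)..σ τ, frob (pathHat (traceDistr x τ σ) (tracePath Q τ Λ σ) t)⁻¹
        (pathDeriv (tracePath Q τ Λ σ) t) =
      frob (weightedTail x τ (Q - Λ τ) Λ' 0)⁻¹ (Λ 0)
        + ∫ q in (0 : ℝ)..τ, frob (weightedTail x τ (Q - Λ τ) Λ' q)⁻¹ (Λ' q) := by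
  have hmono := hΛ.trace_left_le_right
  have hint : ∀ {a b : ℝ}, 0 ≤ a → a ≤ b → b ≤ σ τ → IntervalIntegrable (fun t =>
      frobCLM (pathHat (traceDistr x τ σ) (tracePath Q τ Λ σ) t)⁻¹
        (pathDeriv (tracePath Q τ Λ σ) t)) volume a b := fun ha hab hb =>
    intervalIntegrable_bilinear frobCLM hab
      (hT.isLipschitzPrimitiveOn_pathHat_inv.mono ha hb).continuousOn
      ((hT.isLipschitzPrimitiveOn.mono ha hb).intervalIntegrable hab)
  have hinitial : ∫ t in (0 : ℝ)..σ 0, frobCLM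
      (pathHat (traceDistr x τ σ) (tracePath Q τ Λ σ) t)⁻¹ (pathDeriv (tracePath Q τ Λ σ) t) =
      frobCLM (weightedTail x τ (Q - Λ τ) Λ' 0)⁻¹ (Λ 0) := by
    have hconst : ∀ᵐ t, t ∈ uIoc 0 (σ 0) → frobCLM
        (pathHat (traceDistr x τ σ) (tracePath Q τ Λ σ) t)⁻¹ (pathDeriv (tracePath Q τ Λ σ) t) =
        (σ 0)⁻¹ * frobCLM (weightedTail x τ (Q - Λ τ) Λ' 0)⁻¹ (Λ 0) := by
      filter_upwards [Measure.ae_ne volume (σ 0)] with t ht hmem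
      rw [uIoc_of_le hΛ.trace_left_pos.le] at hmem
      rw [hΛ.pathHat_trace_initial hT (Ioc_subset_Icc_self hmem),
        hΛ.pathDeriv_tracePath_initial hT.lt.le (lt_of_le_of_ne hmem.2 ht), map_smul, smul_eq_mul]
    rw [intervalIntegral.integral_congr_ae hconst, intervalIntegral.integral_const, sub_zero,
      smul_eq_mul, mul_inv_cancel_left₀ hΛ.trace_left_pos.ne']
  simp only [← frobCLM_apply]
  rw [← intervalIntegral.integral_add_adjacent_intervals
    (hint le_rfl hΛ.trace_left_pos.le hmono) (hint hΛ.trace_left_pos.le hmono le_rfl), hinitial,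
    hΛ.intervalIntegral_pathDeriv_tracePath hT.lt.le (fun t => frobCLM
      (pathHat (traceDistr x τ σ) (tracePath Q τ Λ σ) t)⁻¹) le_rfl hΛ.nonneg le_rfl]
  refine congrArg _ (intervalIntegral.integral_congr fun q hq => ?_)
  rw [uIcc_of_le hΛ.nonneg] at hq
  simp only [hΛ.pathHat_trace_apply hT hq]

variable {β : ℕ → Fin m → ℝ} (hβ : ∀ j, Summable fun p : ℕ => (2 : ℝ) ^ p * β p j ^ 2)
  (h : Fin m → ℝ)

include hβ

lemma integral_traceDistr_mul (hQ : ∀ i, Q i i = 1) :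
    ∫ t in (0 : ℝ)..σ τ, traceDistr x τ σ t * frob (xiPrime β (tracePath Q τ Λ σ t)
        + Matrix.vecMulVec h h) (pathDeriv (tracePath Q τ Λ σ) t) =
      ∫ q in (0 : ℝ)..τ, x q * frob (xiPrime β (Λ q) + Matrix.vecMulVec h h) (Λ' q) := by
  have hmono := hΛ.trace_left_le_right
  have henergy := hT.path.isLipschitzPrimitiveOn.xiTotal hβ h
    fun t ht i j => (hT.path.abs_entry_le_one hQ ht i j).trans_lt (by norm_num)
  have hint : ∀ {a b : ℝ}, 0 ≤ a → a ≤ b → b ≤ σ τ → IntervalIntegrable (fun t =>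
      traceDistr x τ σ t * frob (xiPrime β (tracePath Q τ Λ σ t) + Matrix.vecMulVec h h)
        (pathDeriv (tracePath Q τ Λ σ) t)) volume a b := fun ha hab hb =>
    hT.distr.intervalIntegrable_smul ha (hb.trans hT.lt.le) hab
      ((henergy.mono ha (hb.trans hT.lt.le)).intervalIntegrable hab)
  have hinitial : ∫ t in (0 : ℝ)..σ 0, traceDistr x τ σ t * frob
      (xiPrime β (tracePath Q τ Λ σ t) + Matrix.vecMulVec h h)
      (pathDeriv (tracePath Q τ Λ σ) t) = 0 := by
    refine intervalIntegral.integral_zero_ae ?_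
    filter_upwards [Measure.ae_ne volume (σ 0)] with t ht hmem
    rw [uIoc_of_le hΛ.trace_left_pos.le] at hmem
    rw [traceDistr_of_lt (lt_of_le_of_ne hmem.2 ht), zero_mul]
  rw [← intervalIntegral.integral_add_adjacent_intervals
    (hint le_rfl hΛ.trace_left_pos.le hmono) (hint hΛ.trace_left_pos.le hmono le_rfl), hinitial,
    zero_add]
  refine (hΛ.intervalIntegral_pathDeriv_tracePath hT.lt.le (fun t => traceDistr x τ σ t •
    frobCLM (xiPrime β (tracePath Q τ Λ σ t) + Matrix.vecMulVec h h)) le_rfl hΛ.nonneg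
    le_rfl).trans (intervalIntegral.integral_congr fun q hq => ?_)
  rw [uIcc_of_le hΛ.nonneg] at hq
  simp only [traceDistr_of_ge (σ.monotone hq.1), traceInv_apply hq,
    hΛ.tracePath_apply hT.lt.le hq, FunLike.coe_smul, Pi.smul_apply, frobCLM_apply, smul_eq_mul]

lemma two_mul_crisantiSommers_trace (hQ : ∀ i, Q i i = 1) :
    2 * crisantiSommers β h (traceDistr x τ σ) (tracePath Q τ Λ σ) (σ τ) =
      curveFunctional β h Q x τ Λ Λ' := by
  rw [hT.two_mul_crisantiSommers hβ h hQ, hΛ.integral_traceDistr_mul hT hβ h hQ,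
    hΛ.integral_inv_pathHat_trace hT,
    hΛ.tracePath_apply hT.lt.le (right_mem_Icc.2 hΛ.nonneg), curveFunctional, ← add_assoc]

end Functional

end IsMonotoneCurve

end TraceParametrization

lemma IsMinimizer.curveFunctional_le {m : ℕ} {β : ℕ → Fin m → ℝ} {h : Fin m → ℝ}
    {Q : Matrix (Fin m) (Fin m) ℝ} {x : ℝ → ℝ} {Φ Λ Λ' : ℝ → Matrix (Fin m) (Fin m) ℝ} {τ : ℝ}
    {σ : ℝ ≃o ℝ} {σ' : ℝ → ℝ} (hmin : IsMinimizer β h Q x Φ)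
    (hβ : ∀ j, Summable fun p : ℕ => (2 : ℝ) ^ p * β p j ^ 2) (hQ : ∀ i, Q i i = 1)
    (hT : IsTruncated Q x Φ τ) (hΛ : IsMonotoneCurve Q τ Λ Λ' σ σ') :
    curveFunctional β h Q x τ Φ (pathDeriv Φ) ≤ curveFunctional β h Q x τ Λ Λ' := by
  have hQtrace : Q.trace = m := by
    simp only [Matrix.trace, Matrix.diag_apply, hQ, Finset.sum_const, Finset.card_univ,
      Fintype.card_fin, nsmul_eq_mul, mul_one]
  obtain ⟨s, hs, hsτ⟩ := exists_between hT.cutoff.1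
  have hT' := hΛ.isTruncated_trace hT.distr hQtrace hT.lt ⟨topTime_nonneg.trans hs.le, hsτ⟩
    (hT.distr.eq_one_of_topTime_lt hs (hsτ.trans hT.lt).le)
  rw [hT.curveFunctional_eq hβ h hQ, ← hΛ.two_mul_crisantiSommers_trace hT' hβ h hQ]
  exact mul_le_mul_of_nonneg_left (hmin.2 _ _ hT'.toIsAdmissible
    (traceDistr_of_lt hΛ.trace_left_pos) _ _ hT.cutoff hT'.cutoff) zero_le_two

section FirstVariation

variable {m : ℕ} {β : ℕ → Fin m → ℝ} {Q : Matrix (Fin m) (Fin m) ℝ} {x : ℝ → ℝ}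
  {Φ Θ Θ' : ℝ → Matrix (Fin m) (Fin m) ℝ} {τ : ℝ} {μ : Measure ℝ}

/-- The matrix `∫_0^t Φ̂(s)⁻¹ Φ'(s) Φ̂(s)⁻¹ ds` on the right-hand side of the stationarity
equation. -/
def conjIntegral (x : ℝ → ℝ) (Φ : ℝ → Matrix (Fin m) (Fin m) ℝ) (t : ℝ) :
    Matrix (Fin m) (Fin m) ℝ :=
  ∫ s in (0 : ℝ)..t, (pathHat x Φ s)⁻¹ * pathDeriv Φ s * (pathHat x Φ s)⁻¹

/-- The difference between the two sides of the stationarity equation at `t`. It is minus the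
density, with respect to the Parisi measure, of the first variation of the Crisanti–Sommers
functional in the path. -/
def defect (β : ℕ → Fin m → ℝ) (h : Fin m → ℝ) (x : ℝ → ℝ)
    (Φ : ℝ → Matrix (Fin m) (Fin m) ℝ) (t : ℝ) : Matrix (Fin m) (Fin m) ℝ :=
  xiPrime β (Φ t) + Matrix.vecMulVec h h - conjIntegral x Φ t

lemma IsTruncated.isLipschitzPrimitiveOn_conjIntegral (hT : IsTruncated Q x Φ τ) :
    IsLipschitzPrimitiveOn (conjIntegral x Φ)
      (fun t => (pathHat x Φ t)⁻¹ * pathDeriv Φ t * (pathHat x Φ t)⁻¹) 0 τ :=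
  hT.isLipschitzPrimitiveOn.integral_mul_mul hT.nonneg
    hT.isLipschitzPrimitiveOn_pathHat_inv.continuousOn
    hT.isLipschitzPrimitiveOn_pathHat_inv.continuousOn

section Energy

variable (hβ : ∀ j, Summable fun p : ℕ => (2 : ℝ) ^ p * β p j ^ 2) (h : Fin m → ℝ)

include hβ

lemma curveFunctional_eq_sub_setIntegral {Λ Λ' : ℝ → Matrix (Fin m) (Fin m) ℝ}
    (hx : IsDistributionPath m x) (hμ : IsParisiMeasure m x μ) (hτ : τ ∈ Icc (0 : ℝ) m)
    (hxτ : x τ = 1) (hΛ : IsLipschitzPrimitiveOn Λ Λ' 0 τ)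
    (hΛ2 : ∀ t ∈ Icc 0 τ, ∀ i j, |Λ t i j| < 8 / 5) :
    curveFunctional β h Q x τ Λ Λ' =
      xiTotal β h Q - ∫ t in Icc 0 τ, xiTotal β h (Λ t) ∂μ + Real.log (Q - Λ τ).det
      + frob (weightedTail x τ (Q - Λ τ) Λ' 0)⁻¹ (Λ 0)
      + ∫ t in (0 : ℝ)..τ, frob (weightedTail x τ (Q - Λ τ) Λ' t)⁻¹ (Λ' t) := by
  have hparisi := hμ.setIntegral_eq hx hτ (hΛ.xiTotal hβ h hΛ2)
  simp only [hxτ, smul_eq_mul] at hparisi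
  rw [curveFunctional, hparisi]
  ring

lemma hasDerivAt_setIntegral_xiTotal [IsFiniteMeasure μ] {S : Set ℝ} (hS : IsCompact S)
    (hΦ : ContinuousOn Φ S) (hΘ : ContinuousOn Θ S) (hΦ2 : ∀ t ∈ S, ∀ i j, |Φ t i j| < 8 / 5) :
    HasDerivAt (fun ε : ℝ => ∫ t in S, xiTotal β h (Φ t + ε • Θ t) ∂μ)
      (∫ t in S, frob (xiPrime β (Φ t) + Matrix.vecMulVec h h) (Θ t) ∂μ) 0 := by
  have hderiv := hasDerivAt_setIntegral_bilinear_comp (ContinuousLinearMap.mul ℝ ℝ) (ν := μ) hS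
    hΦ hΘ (fun t ht => contDiffAt_xiTotal hβ h (hΦ2 t ht)) (integrable_const (1 : ℝ))
  simp only [ContinuousLinearMap.mul_apply', mul_one] at hderiv
  refine hderiv.congr_deriv (setIntegral_congr_fun hS.measurableSet fun t ht => ?_)
  simp only [(hasFDerivAt_xiTotal hβ h (hΦ2 t ht)).fderiv, frobCLM_apply]

end Energy

namespace IsTruncated

variable (hT : IsTruncated Q x Φ τ) (hΘ : IsLipschitzPrimitiveOn Θ Θ' 0 τ)

include hT

lemma isHermitian_inv_pathHat {t : ℝ} (ht : t ∈ Icc 0 τ) : ((pathHat x Φ t)⁻¹).IsHermitian :=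
  (hT.posDef_pathHat ht).inv.isHermitian

lemma pathHat_right : pathHat x Φ τ = Q - Φ τ := by
  rw [hT.pathHat_eq_weightedTail (right_mem_Icc.2 hT.nonneg), weightedTail_right]

lemma abs_entry_lt (hQ : ∀ i, Q i i = 1) {t : ℝ} (ht : t ∈ Icc 0 τ) (i j : Fin m) :
    |Φ t i j| < 8 / 5 :=
  (hT.path.abs_entry_le_one hQ ⟨ht.1, ht.2.trans hT.lt.le⟩ i j).trans_lt (by norm_num)

lemma isLipschitzPrimitiveOn_xiPrime
    (hβ : ∀ j, Summable fun p : ℕ => (2 : ℝ) ^ p * β p j ^ 2) (hQ : ∀ i, Q i i = 1) :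
    IsLipschitzPrimitiveOn (fun t => xiPrime β (Φ t))
      (fun t => fderiv ℝ (xiPrime β) (Φ t) (pathDeriv Φ t)) 0 τ :=
  hT.isLipschitzPrimitiveOn.contDiffAt_comp fun _ ht =>
    contDiffAt_xiPrime hβ (hT.abs_entry_lt hQ ht)

lemma hasDerivAt_log_det_sub (M : Matrix (Fin m) (Fin m) ℝ) :
    HasDerivAt (fun ε : ℝ => Real.log (Q - (Φ τ + ε • M)).det)
      (-frob (pathHat x Φ τ)⁻¹ M) 0 := by
  have hderiv := hasDerivAt_log_det_add_smul hT.posDef.det_pos.ne'.isUnit (-M)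
  simp only [smul_neg, ← sub_eq_add_neg, sub_sub] at hderiv
  refine hderiv.congr_deriv ?_
  rw [← hT.pathHat_right, frob_eq_trace,
    (hT.isHermitian_inv_pathHat (right_mem_Icc.2 hT.nonneg)).eq, mul_neg, Matrix.trace_neg]

include hΘ

lemma weightedTail_add_smul {t : ℝ} (ht : t ∈ Icc 0 τ) (ε : ℝ) :
    weightedTail x τ (Q - (Φ τ + ε • Θ τ)) (fun s => pathDeriv Φ s + ε • Θ' s) t =
      pathHat x Φ t + ε • weightedTail x τ (-Θ τ) Θ' t := by
  rw [hT.pathHat_eq_weightedTail ht, ← hT.distr.weightedTail_add_smul hT.mem_Icc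
    hT.isLipschitzPrimitiveOn hΘ _ _ ε ht, smul_neg, ← sub_eq_add_neg, sub_sub]

lemma hasDerivAt_integral_frob_inv_weightedTail :
    HasDerivAt (fun ε : ℝ => ∫ t in (0 : ℝ)..τ,
        frob (weightedTail x τ (Q - (Φ τ + ε • Θ τ)) (fun s => pathDeriv Φ s + ε • Θ' s) t)⁻¹
          (pathDeriv Φ t + ε • Θ' t))
      (∫ t in (0 : ℝ)..τ, frob (pathHat x Φ t)⁻¹ (Θ' t) -
        frob ((pathHat x Φ t)⁻¹ * pathDeriv Φ t * (pathHat x Φ t)⁻¹)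
          (weightedTail x τ (-Θ τ) Θ' t)) 0 := by
  have hunit : ∀ t ∈ Icc 0 τ, IsUnit (pathHat x Φ t) := fun t ht => (hT.posDef_pathHat ht).isUnit
  have hint : ∀ {k k' : ℝ → Matrix (Fin m) (Fin m) ℝ}, IsLipschitzPrimitiveOn k k' 0 τ →
      IntegrableOn k' (Icc 0 τ) := fun hk =>
    (intervalIntegrable_iff_integrableOn_Icc_of_le hT.nonneg).1 (hk.intervalIntegrable hT.nonneg)
  have hderiv := hasDerivAt_setIntegral_bilinear_comp_add_smul frobCLM (ν := volume)
    isCompact_Icc hT.isLipschitzPrimitiveOn_pathHat.continuousOn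
    (hT.distr.isLipschitzPrimitiveOn_weightedTail hT.mem_Icc hΘ (-Θ τ)).continuousOn
    (fun t ht => contDiffAt_matrix_inv (hunit t ht)) (hint hT.isLipschitzPrimitiveOn) (hint hΘ)
  simp only [intervalIntegral.integral_of_le hT.nonneg, ← integral_Icc_eq_integral_Ioc]
  refine (hderiv.congr_of_eventuallyEq (Eventually.of_forall fun ε =>
    setIntegral_congr_fun measurableSet_Icc fun t ht => ?_)).congr_deriv
    (setIntegral_congr_fun measurableSet_Icc fun t ht => ?_)
  · simp only [hT.weightedTail_add_smul hΘ ht ε, frobCLM_apply]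
  · simp only [fderiv_matrix_inv (hunit t ht), map_neg, neg_apply,
      frobCLM_apply, frob_conj_comm (hT.isHermitian_inv_pathHat ht) (B := pathDeriv Φ t)]
    ring

lemma setIntegral_frob_conjIntegral (hμ : IsParisiMeasure m x μ) :
    ∫ t in Icc 0 τ, frob (conjIntegral x Φ t) (Θ t) ∂μ =
      frob (pathHat x Φ 0)⁻¹ (Θ 0) - frob (pathHat x Φ τ)⁻¹ (Θ τ) +
        ∫ t in (0 : ℝ)..τ, frob (pathHat x Φ t)⁻¹ (Θ' t) -
          frob ((pathHat x Φ t)⁻¹ * pathDeriv Φ t * (pathHat x Φ t)⁻¹)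
            (weightedTail x τ (-Θ τ) Θ' t) := by
  have hpair := hT.isLipschitzPrimitiveOn_conjIntegral.bilinear frobCLM hΘ
  have htail := hT.distr.isLipschitzPrimitiveOn_weightedTail hT.mem_Icc hΘ (-Θ τ)
  have hparts := (hT.isLipschitzPrimitiveOn_pathHat_inv.bilinear frobCLM hΘ).sub
    (hT.isLipschitzPrimitiveOn_conjIntegral.bilinear frobCLM htail)
  have hweighted := hT.distr.intervalIntegrable_smul le_rfl hT.lt.le hT.nonneg
    (hpair.intervalIntegrable hT.nonneg)
  have hsub := intervalIntegral.integral_sub (hparts.intervalIntegrable hT.nonneg) hweighted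
  rw [hparts.integral_eq_sub hT.nonneg] at hsub
  have hzero : conjIntegral x Φ 0 = 0 := intervalIntegral.integral_same
  have hparisi := hμ.setIntegral_eq hT.distr hT.mem_Icc hpair
  simp only [hT.eq_one_of_le le_rfl hT.lt.le, weightedTail_right, hzero, map_zero, zero_apply,
    sub_zero, map_neg, map_smul, FunLike.coe_smul, Pi.smul_apply, frobCLM_apply, smul_eq_mul,
    one_mul] at hsub hparisi
  rw [hparisi, ← sub_eq_iff_eq_add', eq_comm]
  refine (intervalIntegral.integral_congr fun t _ => ?_).trans (hsub.trans ?_)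
  · ring
  · ring

theorem hasDerivAt_curveFunctional
    (hβ : ∀ j, Summable fun p : ℕ => (2 : ℝ) ^ p * β p j ^ 2) (h : Fin m → ℝ)
    (hQ : ∀ i, Q i i = 1) (hμ : IsParisiMeasure m x μ) :
    HasDerivAt (fun ε : ℝ => curveFunctional β h Q x τ (fun t => Φ t + ε • Θ t)
        (fun t => pathDeriv Φ t + ε • Θ' t))
      (-∫ t in Icc 0 τ, frob (defect β h x Φ t) (Θ t) ∂μ) 0 := by
  have := hμ.isProbabilityMeasure hT.distr.right_end
  have hΦ := hT.isLipschitzPrimitiveOn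
  have hzero : (0 : ℝ) ∈ Icc 0 τ := left_mem_Icc.2 hT.nonneg
  have hΦ2 : ∀ t ∈ Icc 0 τ, ∀ i j, |Φ t i j| < 8 / 5 := fun t ht => hT.abs_entry_lt hQ ht
  have hopen : IsOpen {A : Matrix (Fin m) (Fin m) ℝ | ∀ i j, |A i j| < 8 / 5} := by
    simp only [ofPred_forall]
    exact isOpen_iInter_of_finite fun i => isOpen_iInter_of_finite fun j =>
      isOpen_lt (continuous_id.matrix_elem i j).abs continuous_const
  have hderiv := ((((hasDerivAt_setIntegral_xiTotal hβ h (μ := μ) isCompact_Icc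
    hΦ.continuousOn hΘ.continuousOn hΦ2).const_sub (xiTotal β h Q)).add
    (hT.hasDerivAt_log_det_sub (Θ τ))).add
    (hasDerivAt_frob_inv_add_smul_smul (B := Θ 0) (hT.posDef_pathHat hzero).isUnit
      (weightedTail x τ (-Θ τ) Θ' 0))).add (hT.hasDerivAt_integral_frob_inv_weightedTail hΘ)
  refine (hderiv.congr_of_eventuallyEq ?_).congr_deriv ?_
  · filter_upwards [eventually_forall_add_smul_mem isCompact_Icc hΦ.continuousOn
      hΘ.continuousOn hopen hΦ2] with ε hε
    rw [curveFunctional_eq_sub_setIntegral hβ h hT.distr hμ hT.mem_Icc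
      (hT.eq_one_of_le le_rfl hT.lt.le) (hΦ.add (hΘ.const_smul ε)) hε,
      hT.weightedTail_add_smul hΘ hzero, hT.path.left_end, zero_add]
    rfl
  · have hint : ∀ {X X' : ℝ → Matrix (Fin m) (Fin m) ℝ}, IsLipschitzPrimitiveOn X X' 0 τ →
        IntegrableOn (fun t => frobCLM (X t) (Θ t)) (Icc 0 τ) μ := fun hX =>
      ((hX.bilinear frobCLM hΘ).continuousOn).integrableOn_Icc
    have hsplit : ∫ t in Icc 0 τ, frob (defect β h x Φ t) (Θ t) ∂μ =
        ∫ t in Icc 0 τ, frob (xiPrime β (Φ t) + Matrix.vecMulVec h h) (Θ t) ∂μ -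
          ∫ t in Icc 0 τ, frob (conjIntegral x Φ t) (Θ t) ∂μ := by
      simp only [defect, ← frobCLM_apply, map_sub, sub_apply]
      exact integral_sub (hint ((hT.isLipschitzPrimitiveOn_xiPrime hβ hQ).add (.const _ _ _)))
        (hint hT.isLipschitzPrimitiveOn_conjIntegral)
    rw [hsplit, hT.setIntegral_frob_conjIntegral hΘ hμ]
    ring

end IsTruncated

end FirstVariation

section Stationarity

lemma exists_orderIso_mul_add {c : ℝ} (hc : 0 < c) {φ : ℝ → ℝ} (hφ : Monotone φ)
    (hcont : Continuous φ) : ∃ σ : ℝ ≃o ℝ, ∀ t, σ t = c * t + φ t := by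
  have hmono : StrictMono fun t => c * t + φ t :=
    (strictMono_mul_left_of_pos hc).add_monotone hφ
  have htop : Tendsto (fun t => c * t + φ t) atTop atTop :=
    tendsto_atTop_add_right_of_le' _ (φ 0) (tendsto_id.const_mul_atTop hc)
      ((eventually_ge_atTop 0).mono fun t ht => hφ ht)
  have hbot : Tendsto (fun t => c * t + φ t) atBot atBot :=
    tendsto_atBot_add_right_of_ge' _ (φ 0) (tendsto_id.const_mul_atBot hc)
      ((eventually_le_atBot 0).mono fun t ht => hφ ht)
  have hsurj : Function.Surjective fun t => c * t + φ t :=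
    ((continuous_const.mul continuous_id).add hcont).surjective htop hbot
  exact ⟨hmono.orderIsoOfSurjective _ hsurj, fun t => rfl⟩

variable {m : ℕ} {β : ℕ → Fin m → ℝ} {h : Fin m → ℝ} {Q P : Matrix (Fin m) (Fin m) ℝ}
  {x φ : ℝ → ℝ} {Φ : ℝ → Matrix (Fin m) (Fin m) ℝ} {τ : ℝ} {μ : Measure ℝ}

lemma IsTruncated.isLipschitzPrimitiveOn_smul_sub_smul (hT : IsTruncated Q x Φ τ)
    (hφ : ContDiff ℝ 1 φ) (P : Matrix (Fin m) (Fin m) ℝ) (a : ℝ) :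
    IsLipschitzPrimitiveOn (fun t => φ t • P - a • Φ t)
      (fun t => deriv φ t • P - a • pathDeriv Φ t) 0 τ := by
  have hid : IsLipschitzPrimitiveOn (fun t : ℝ => t) (fun _ => 1) 0 τ :=
    ⟨⟨1, LipschitzWith.id.lipschitzOnWith⟩, ae_of_all _ fun t _ => hasDerivAt_id t⟩
  exact ((hid.contDiffAt_comp fun t _ => hφ.contDiffAt).clm_comp
    (.toSpanSingleton ℝ P)).sub (hT.isLipschitzPrimitiveOn.const_smul a)

lemma IsTruncated.exists_isMonotoneCurve (hT : IsTruncated Q x Φ τ) (hφ : ContDiff ℝ 1 φ)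
    (hmono : Monotone φ) (hφ0 : 0 < φ 0) (hP : P.PosSemidef) (hPtrace : 0 < P.trace) {a ε : ℝ}
    (hε : 0 < ε) (hεa : ε * a < 1) (hpos : (Q - Φ τ + ε • -(φ τ • P - a • Φ τ)).PosDef) :
    ∃ σ σ', IsMonotoneCurve Q τ (fun t => Φ t + ε • (φ t • P - a • Φ t))
      (fun t => pathDeriv Φ t + ε • (deriv φ t • P - a • pathDeriv Φ t)) σ σ' := by
  have hc : 0 < 1 - ε * a := sub_pos.2 hεa
  have hcP : 0 < ε * P.trace := mul_pos hε hPtrace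
  obtain ⟨σ, hσ⟩ := exists_orderIso_mul_add hc (hmono.const_mul hcP.le)
    (hφ.continuous.const_mul (ε * P.trace))
  have hderiv : ∀ t, HasDerivAt σ ((1 - ε * a) * 1 + ε * P.trace * deriv φ t) t := fun t =>
    (((hasDerivAt_id t).const_mul _).add
      (((hφ.differentiable one_ne_zero t).hasDerivAt).const_mul _)).congr_of_eventuallyEq
      (Eventually.of_forall hσ)
  refine ⟨σ, _, ⟨hT.nonneg, hT.isLipschitzPrimitiveOn.add
    ((hT.isLipschitzPrimitiveOn_smul_sub_smul hφ P a).const_smul ε), fun s hs t ht hst => ?_, ?_,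
    ?_, fun t ht => ?_, hderiv, fun t => ?_, ?_⟩⟩
  · have hsplit : Φ t + ε • (φ t • P - a • Φ t) - (Φ s + ε • (φ s • P - a • Φ s)) =
        (1 - ε * a) • (Φ t - Φ s) + (ε * (φ t - φ s)) • P := by module
    rw [hsplit]
    exact ((hT.path.mono s ⟨hs.1, hs.2.trans hT.lt.le⟩ t ⟨ht.1, ht.2.trans hT.lt.le⟩ hst).smul
      hc.le).add (hP.smul (mul_nonneg hε.le (sub_nonneg.2 (hmono hst))))
  · rw [hT.path.left_end, smul_zero, sub_zero, zero_add, smul_smul]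
    exact hP.smul (mul_pos hε hφ0).le
  · simpa only [smul_neg, ← sub_eq_add_neg, sub_sub] using hpos
  · rw [hσ, Matrix.trace_add, Matrix.trace_smul, Matrix.trace_sub, Matrix.trace_smul,
      Matrix.trace_smul, hT.path.trace_eq t ⟨ht.1, ht.2.trans hT.lt.le⟩]
    simp only [smul_eq_mul]
    ring
  · have hφ' : 0 ≤ deriv φ t := hmono.deriv_nonneg
    positivity
  · rw [hσ, mul_zero, zero_add]
    exact mul_pos hcP hφ0

lemma IsTruncated.eventually_exists_isMonotoneCurve (hT : IsTruncated Q x Φ τ)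
    (hφ : ContDiff ℝ 1 φ) (hmono : Monotone φ) (hφ0 : 0 < φ 0) (hP : P.PosSemidef)
    (hPtrace : 0 < P.trace) (a : ℝ) : ∀ᶠ ε in 𝓝[>] (0 : ℝ), ∃ σ σ',
      IsMonotoneCurve Q τ (fun t => Φ t + ε • (φ t • P - a • Φ t))
        (fun t => pathDeriv Φ t + ε • (deriv φ t • P - a • pathDeriv Φ t)) σ σ' := by
  have hscale : ∀ᶠ ε in 𝓝 (0 : ℝ), ε * a < 1 :=
    (continuous_id.mul continuous_const).continuousAt.eventually_lt continuousAt_const (by simp)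
  have hherm : (-(φ τ • P - a • Φ τ)).IsHermitian :=
    ((hP.isHermitian.smul (IsSelfAdjoint.all _)).sub
      ((hT.path.posSemidef τ hT.mem_Icc).isHermitian.smul (IsSelfAdjoint.all _))).neg
  filter_upwards [hscale.filter_mono nhdsWithin_le_nhds,
    (eventually_posDef_add_smul hT.posDef hherm).filter_mono nhdsWithin_le_nhds,
    self_mem_nhdsWithin] with ε hεa hpos hε
  exact hT.exists_isMonotoneCurve hφ hmono hφ0 hP hPtrace hε hεa hpos

lemma exists_contDiff_tendsto_indicator_Ici (r : ℝ) : ∃ φ : ℕ → ℝ → ℝ,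
    (∀ n, ContDiff ℝ 1 (φ n)) ∧ (∀ n, Monotone (φ n)) ∧ (∀ n t, φ n t ∈ Ioc 0 2) ∧
      ∀ t, Tendsto (φ · t) atTop (𝓝 ((Ici r).indicator 1 t)) := by
  refine ⟨fun n t => 1 / ((n : ℝ) + 1) + Real.smoothTransition (1 + n * (t - r)), fun n =>
    contDiff_const.add (Real.smoothTransition.contDiff.comp (by fun_prop)), fun n s t hst => ?_,
    fun n t => ⟨?_, ?_⟩, fun t => ?_⟩
  · have hstep : Real.smoothTransition (1 + n * (s - r)) ≤
        Real.smoothTransition (1 + n * (t - r)) := Real.smoothTransition.monotone (by gcongr)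
    exact add_le_add_right hstep _
  · exact add_pos_of_pos_of_nonneg Nat.one_div_pos_of_nat (Real.smoothTransition.nonneg _)
  · have hle : 1 / ((n : ℝ) + 1) ≤ 1 := by
      rw [div_le_one (by positivity)]
      linarith [n.cast_nonneg (α := ℝ)]
    linarith [Real.smoothTransition.le_one (1 + n * (t - r))]
  · suffices hstep : ∀ᶠ n : ℕ in atTop,
        Real.smoothTransition (1 + n * (t - r)) = (Ici r).indicator 1 t by
      simpa only [zero_add] using
        tendsto_one_div_add_atTop_nhds_zero_nat.add
          (tendsto_const_nhds.congr' (EventuallyEq.symm hstep))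
    rcases le_or_gt r t with hrt | htr
    · refine Eventually.of_forall fun n => ?_
      rw [indicator_of_mem (mem_Ici.2 hrt), Pi.one_apply]
      exact Real.smoothTransition.one_of_one_le
        (le_add_of_nonneg_right (mul_nonneg n.cast_nonneg (sub_nonneg.2 hrt)))
    · have hbot : Tendsto (fun n : ℕ => (n : ℝ) * (t - r)) atTop atBot :=
        tendsto_natCast_atTop_atTop.atTop_mul_const_of_neg (sub_neg.2 htr)
      filter_upwards [hbot.eventually (eventually_le_atBot (-1))] with n hn
      rw [indicator_of_notMem (notMem_Ici.2 htr)]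
      exact Real.smoothTransition.zero_of_nonpos (by linarith)

lemma setIntegral_Icc_nonpos_of_forall_contDiff {g : ℝ → ℝ} {a b r : ℝ}
    (hg : IntegrableOn g (Icc a b) μ) (hr : a ≤ r) (htest : ∀ φ : ℝ → ℝ, ContDiff ℝ 1 φ →
      Monotone φ → (∀ t, 0 < φ t) → ∫ t in Icc a b, φ t * g t ∂μ ≤ 0) :
    ∫ t in Icc r b, g t ∂μ ≤ 0 := by
  obtain ⟨φ, hφ, hmono, hmem, hlim⟩ := exists_contDiff_tendsto_indicator_Ici r
  have hlim' : Tendsto (fun n => ∫ t in Icc a b, φ n t * g t ∂μ) atTop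
      (𝓝 (∫ t in Icc a b, (Ici r).indicator 1 t * g t ∂μ)) := by
    refine tendsto_integral_of_dominated_convergence (fun t => 2 * ‖g t‖)
      (fun n => (hφ n).continuous.aestronglyMeasurable.mul hg.1) (hg.norm.const_mul 2)
      (fun n => ae_of_all _ fun t => ?_) (ae_of_all _ fun t => (hlim t).mul_const (g t))
    rw [norm_mul, Real.norm_of_nonneg (hmem n t).1.le]
    exact mul_le_mul_of_nonneg_right (hmem n t).2 (norm_nonneg _)
  refine (le_of_eq ?_).trans (le_of_tendsto' hlim' fun n =>
    htest _ (hφ n) (hmono n) fun t => (hmem n t).1)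
  rw [← setIntegral_Ici_restrict_Icc hr, ← integral_indicator measurableSet_Ici]
  simp only [← indicator_mul_left, Pi.one_apply, one_mul]

namespace IsTruncated

variable (hT : IsTruncated Q x Φ τ)

include hT

lemma isHermitian_defect {t : ℝ} (ht : t ∈ Icc 0 τ) : (defect β h x Φ t).IsHermitian := by
  have hconj : (conjIntegral x Φ t).IsHermitian := by
    rw [conjIntegral, intervalIntegral.integral_of_le ht.1]
    refine (posSemidef_integral ((ae_restrict_iff' measurableSet_Ioc).2 ?_)).isHermitian
    filter_upwards [hT.path.posSemidef_pathDeriv] with s hs hmem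
    exact posSemidef_mul_mul_same (hT.isHermitian_inv_pathHat ⟨hmem.1.le, hmem.2.trans ht.2⟩)
      (hs ⟨hmem.1, (hmem.2.trans ht.2).trans_lt hT.lt⟩)
  have hxi : (xiPrime β (Φ t)).IsHermitian :=
    isHermitian_xiPrime (hT.path.posSemidef t ⟨ht.1, ht.2.trans hT.lt.le⟩).isHermitian
  exact (hxi.add (posSemidef_vecMulVec_self h).isHermitian).sub hconj

lemma isLipschitzPrimitiveOn_defect
    (hβ : ∀ j, Summable fun p : ℕ => (2 : ℝ) ^ p * β p j ^ 2) (hQ : ∀ i, Q i i = 1) :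
    IsLipschitzPrimitiveOn (defect β h x Φ)
      (fun t => fderiv ℝ (xiPrime β) (Φ t) (pathDeriv Φ t) -
        (pathHat x Φ t)⁻¹ * pathDeriv Φ t * (pathHat x Φ t)⁻¹) 0 τ :=
  (((hT.isLipschitzPrimitiveOn_xiPrime hβ hQ).add (.const _ _ _)).sub
    hT.isLipschitzPrimitiveOn_conjIntegral).congr_deriv
    (ae_of_all _ fun _ _ => by rw [add_zero])

end IsTruncated

section Minimizer

variable (hmin : IsMinimizer β h Q x Φ)
  (hβ : ∀ j, Summable fun p : ℕ => (2 : ℝ) ^ p * β p j ^ 2) (hQ : ∀ i, Q i i = 1)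
  (hT : IsTruncated Q x Φ τ) (hμ : IsParisiMeasure m x μ)

include hmin hβ hQ hT hμ

namespace IsMinimizer

lemma setIntegral_frob_defect_nonpos (hφ : ContDiff ℝ 1 φ) (hmono : Monotone φ) (hφ0 : 0 < φ 0)
    (hP : P.PosSemidef) (hPtrace : 0 < P.trace) (a : ℝ) :
    ∫ t in Icc 0 τ, frob (defect β h x Φ t) (φ t • P - a • Φ t) ∂μ ≤ 0 := by
  have hderiv := hT.hasDerivAt_curveFunctional (hT.isLipschitzPrimitiveOn_smul_sub_smul hφ P a)
    hβ h hQ hμ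
  refine neg_nonneg.1 (ge_of_tendsto hderiv.tendsto_slope_zero_right ?_)
  filter_upwards [hT.eventually_exists_isMonotoneCurve hφ hmono hφ0 hP hPtrace a,
    self_mem_nhdsWithin] with ε ⟨σ, σ', hΛ⟩ (hε : 0 < ε)
  simp only [zero_add, zero_smul, add_zero]
  exact smul_nonneg (inv_nonneg.2 hε.le) (sub_nonneg.2 (hmin.curveFunctional_le hβ hQ hT hΛ))

lemma posSemidef_neg_setIntegral_defect {r : ℝ} (hr : 0 ≤ r) :
    (-∫ t in Icc r τ, defect β h x Φ t ∂μ).PosSemidef := by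
  have := hμ.isProbabilityMeasure hT.distr.right_end
  have hint : IntegrableOn (defect β h x Φ) (Icc 0 τ) μ :=
    (hT.isLipschitzPrimitiveOn_defect hβ hQ).continuousOn.integrableOn_Icc
  have hherm : (∫ t in Icc r τ, defect β h x Φ t ∂μ).IsHermitian :=
    isHermitian_integral ((ae_restrict_iff' measurableSet_Icc).2
      (ae_of_all _ fun t ht => hT.isHermitian_defect ⟨hr.trans ht.1, ht.2⟩))
  refine Matrix.PosSemidef.of_dotProduct_mulVec_nonneg hherm.neg fun v => ?_
  rcases eq_or_ne v 0 with rfl | hv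
  · simp only [Matrix.mulVec_zero, dotProduct_zero, le_refl]
  rw [star_trivial, ← frob_vecMulVec_self, frob_comm, ← frobCLM_apply, map_neg, frobCLM_apply,
    neg_nonneg, frob_comm, ← frobCLM_apply, ← frobCLM.flip_apply,
    ← (frobCLM.flip _).integral_comp_comm (hint.mono_set (Icc_subset_Icc_left hr))]
  refine setIntegral_Icc_nonpos_of_forall_contDiff ((frobCLM.flip _).integrable_comp hint) hr
    fun φ hφ hmono hpos => ?_
  have htrace : 0 < (Matrix.vecMulVec v v).trace := by
    simpa only [Matrix.trace_vecMulVec, star_trivial] using Matrix.dotProduct_star_self_pos_iff.2 hv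
  refine (le_of_eq ?_).trans (hmin.setIntegral_frob_defect_nonpos hβ hQ hT hμ hφ hmono (hpos 0)
    (posSemidef_vecMulVec_self v) htrace 0)
  simp only [zero_smul, sub_zero, ← frobCLM_apply, map_smul, smul_eq_mul, frobCLM.flip_apply]

lemma setIntegral_frob_defect_path_nonneg :
    0 ≤ ∫ t in Icc 0 τ, frob (defect β h x Φ t) (Φ t) ∂μ := by
  have := hμ.isProbabilityMeasure hT.distr.right_end
  have hF := hT.isLipschitzPrimitiveOn_defect hβ hQ (h := h)
  have hΦint : IntegrableOn (fun t => frobCLM (defect β h x Φ t) (Φ t)) (Icc 0 τ) μ :=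
    (hF.bilinear frobCLM hT.isLipschitzPrimitiveOn).continuousOn.integrableOn_Icc
  have hint : IntegrableOn (fun t => frobCLM (defect β h x Φ t) 1) (Icc 0 τ) μ :=
    (frobCLM.flip 1).integrable_comp hF.continuousOn.integrableOn_Icc
  have htrace : 0 < (1 : Matrix (Fin m) (Fin m) ℝ).trace := by
    rw [Matrix.trace_one, Fintype.card_fin]
    exact hT.nonneg.trans_lt hT.lt
  have hle : ∀ δ ∈ Ioi (0 : ℝ), δ * ∫ t in Icc 0 τ, frob (defect β h x Φ t) 1 ∂μ ≤
      ∫ t in Icc 0 τ, frob (defect β h x Φ t) (Φ t) ∂μ := fun δ hδ => by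
    have htest := hmin.setIntegral_frob_defect_nonpos hβ hQ hT hμ (contDiff_const (c := δ))
      monotone_const hδ Matrix.PosSemidef.one htrace 1
    simp only [one_smul, ← frobCLM_apply, map_sub, map_smul, smul_eq_mul] at htest
    rwa [integral_sub (hint.const_mul δ) hΦint, integral_const_mul, sub_nonpos] at htest
  have hlim : Tendsto (fun δ : ℝ => δ * ∫ t in Icc 0 τ, frob (defect β h x Φ t) 1 ∂μ)
      (𝓝[>] 0) (𝓝 0) :=
    ((continuous_id.mul continuous_const).tendsto' _ _ (zero_mul _)).mono_left nhdsWithin_le_nhds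
  exact le_of_tendsto hlim (eventually_nhdsWithin_of_forall hle)

lemma ae_setIntegral_defect_mul_pathDeriv_eq_zero :
    ∀ᵐ q, q ∈ Ioo 0 τ → (∫ t in Icc q τ, defect β h x Φ t ∂μ) * pathDeriv Φ q = 0 := by
  have := hμ.isProbabilityMeasure hT.distr.right_end
  have hint : IntegrableOn (defect β h x Φ) (Icc 0 τ) μ :=
    (hT.isLipschitzPrimitiveOn_defect hβ hQ).continuousOn.integrableOn_Icc
  have hΦ := hT.isLipschitzPrimitiveOn
  have hnonneg : ∀ᵐ q ∂volume.restrict (Ioo 0 τ),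
      0 ≤ frobCLM (-∫ t in Icc q τ, defect β h x Φ t ∂μ) (pathDeriv Φ q) := by
    refine (ae_restrict_iff' measurableSet_Ioo).2 ?_
    filter_upwards [hT.posSemidef_pathDeriv] with q hq hmem
    exact frob_nonneg (hmin.posSemidef_neg_setIntegral_defect hβ hQ hT hμ hmem.1.le) (hq hmem)
  have hpair : IntegrableOn
      (fun q => frobCLM (-∫ t in Icc q τ, defect β h x Φ t ∂μ) (pathDeriv Φ q)) (Ioo 0 τ) := by
    simp only [map_neg, neg_apply]
    exact ((intervalIntegrable_iff_integrableOn_Ioo_of_le hT.nonneg).1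
      (hΦ.intervalIntegrable_bilinear_setIntegral frobCLM hT.nonneg hint)).neg
  have hle :
      ∫ q in Ioo 0 τ, frobCLM (-∫ t in Icc q τ, defect β h x Φ t ∂μ) (pathDeriv Φ q) ≤ 0 := by
    have hparts := hΦ.setIntegral_bilinear frobCLM hT.nonneg hint
    rw [hT.path.left_end, map_zero, zero_add, intervalIntegral.integral_of_le hT.nonneg,
      integral_Ioc_eq_integral_Ioo] at hparts
    simp only [map_neg, neg_apply]
    rw [integral_neg, ← hparts, neg_nonpos]
    exact hmin.setIntegral_frob_defect_path_nonneg hβ hQ hT hμ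
  have hzero := (integral_eq_zero_iff_of_nonneg_ae hnonneg hpair).1
    (hle.antisymm (integral_nonneg_of_ae hnonneg))
  filter_upwards [hT.posSemidef_pathDeriv, (ae_restrict_iff' measurableSet_Ioo).1 hzero]
    with q hq hq0 hmem
  have hneg := hmin.posSemidef_neg_setIntegral_defect hβ hQ hT hμ hmem.1.le
  rw [← neg_eq_zero, ← neg_mul]
  refine mul_eq_zero_of_trace_mul_eq_zero hneg (hq hmem) ?_
  rw [← hneg.isHermitian.eq, ← frob_eq_trace]
  exact hq0 hmem

end IsMinimizer

end Minimizer

end Stationarity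

section Rigidity

lemma trace_mul_deriv_conj {n : Type*} [Fintype n] [DecidableEq n] {A F P T U : Matrix n n ℝ}
    (hU : IsUnit U) (hTP : T * P = 0) (hPT : P * T = 0) (c : ℝ) :
    (T * (U * F * -(c • P) + (U * (A - U⁻¹ * P * U⁻¹) + -(c • P) * F) * U)).trace =
      (T * (U * A * U)).trace := by
  have hdet : IsUnit U.det := (Matrix.isUnit_iff_isUnit_det U).1 hU
  have hcancel : U * (U⁻¹ * P * U⁻¹) * U = P := by
    rw [← Matrix.mul_assoc, Matrix.mul_nonsing_inv_cancel_left _ _ hdet,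
      Matrix.nonsing_inv_mul_cancel_right _ _ hdet]
  have hleft : (T * (U * F * P)).trace = 0 := by
    rw [Matrix.trace_mul_comm, Matrix.mul_assoc, hPT, Matrix.mul_zero, Matrix.trace_zero]
  have hright : T * (P * F * U) = 0 := by
    rw [← Matrix.mul_assoc, ← Matrix.mul_assoc, hTP, Matrix.zero_mul, Matrix.zero_mul]
  simp only [mul_neg, neg_mul, Matrix.mul_smul, Matrix.smul_mul, Matrix.add_mul,
    Matrix.mul_add, Matrix.mul_sub, Matrix.sub_mul, Matrix.trace_add, Matrix.trace_neg,
    Matrix.trace_sub, Matrix.trace_smul, hcancel, hTP, hleft, hright]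
  simp only [Matrix.trace_zero, smul_zero, neg_zero, zero_add, sub_zero, add_zero]

variable {m : ℕ} {β : ℕ → Fin m → ℝ} {h : Fin m → ℝ} {Q : Matrix (Fin m) (Fin m) ℝ}
  {x : ℝ → ℝ} {Φ : ℝ → Matrix (Fin m) (Fin m) ℝ} {τ : ℝ} {μ : Measure ℝ}

lemma IsTruncated.posSemidef_defect_zero (hT : IsTruncated Q x Φ τ) :
    (defect β h x Φ 0).PosSemidef := by
  rw [defect, conjIntegral, hT.path.left_end, xiPrime_zero, intervalIntegral.integral_same,
    zero_add, sub_zero]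
  exact posSemidef_vecMulVec_self h

lemma IsTruncated.posSemidef_fderiv_xiPrime
    (hβ : ∀ j, Summable fun p : ℕ => (2 : ℝ) ^ p * β p j ^ 2) (hQ : ∀ i, Q i i = 1)
    (hT : IsTruncated Q x Φ τ) : ∀ᵐ t, t ∈ Ioo 0 τ →
      (fderiv ℝ (xiPrime β) (Φ t) (pathDeriv Φ t)).PosSemidef := by
  filter_upwards [(hT.isLipschitzPrimitiveOn_xiPrime hβ hQ).deriv] with t ht hmem
  refine posSemidef_of_hasDerivAt (ht hmem) ?_
  filter_upwards [Ioo_mem_nhdsGT hmem.2] with s hs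
  have htτ := Ioo_subset_Icc_self hmem
  have hsτ : s ∈ Icc 0 τ := ⟨hmem.1.le.trans hs.1.le, hs.2.le⟩
  have hsub : Icc 0 τ ⊆ Icc 0 (m : ℝ) := Icc_subset_Icc_right hT.lt.le
  exact posSemidef_xiPrime_sub hβ (hT.path.posSemidef t (hsub htτ))
    (hT.path.posSemidef s (hsub hsτ)) (hT.path.mono t (hsub htτ) s (hsub hsτ) hs.1.le)
    (hT.abs_entry_lt hQ htτ) (hT.abs_entry_lt hQ hsτ)

section Minimizer

variable (hmin : IsMinimizer β h Q x Φ)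
  (hβ : ∀ j, Summable fun p : ℕ => (2 : ℝ) ^ p * β p j ^ 2) (hQ : ∀ i, Q i i = 1)
  (hT : IsTruncated Q x Φ τ) (hμ : IsParisiMeasure m x μ)

include hmin hβ hQ hT hμ

namespace IsMinimizer

lemma setIntegral_frob_defect_conj_nonpos :
    ∫ t in Icc 0 τ, frob (defect β h x Φ t) (pathHat x Φ t * defect β h x Φ t * pathHat x Φ t) ∂μ
      ≤ 0 := by
  have := hμ.isProbabilityMeasure hT.distr.right_end
  have hF := hT.isLipschitzPrimitiveOn_defect hβ hQ (h := h)
  have hH := (hT.isLipschitzPrimitiveOn_pathHat.mul hF).mul hT.isLipschitzPrimitiveOn_pathHat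
  have hneg := fun {r : ℝ} (hr : 0 ≤ r) =>
    hmin.posSemidef_neg_setIntegral_defect hβ hQ hT hμ hr
  have hleft : 0 ≤ frob (-∫ t in Icc 0 τ, defect β h x Φ t ∂μ)
      (pathHat x Φ 0 * defect β h x Φ 0 * pathHat x Φ 0) :=
    frob_nonneg (hneg le_rfl) (posSemidef_mul_mul_same
      (hT.posDef_pathHat (left_mem_Icc.2 hT.nonneg)).isHermitian hT.posSemidef_defect_zero)
  have hparts := hH.setIntegral_bilinear frobCLM hT.nonneg
    (hF.continuousOn.integrableOn_Icc (μ := μ))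
  simp only [frobCLM_apply] at hparts
  rw [hparts, ← neg_nonneg, neg_add, ← intervalIntegral.integral_neg]
  simp only [← frobCLM_apply, map_neg, neg_apply] at hleft ⊢
  refine add_nonneg hleft ?_
  rw [intervalIntegral.integral_of_le hT.nonneg, integral_Ioc_eq_integral_Ioo]
  refine integral_nonneg_of_ae ((ae_restrict_iff' measurableSet_Ioo).2 ?_)
  filter_upwards [hmin.ae_setIntegral_defect_mul_pathDeriv_eq_zero hβ hQ hT hμ,
    hT.posSemidef_pathDeriv, hT.posSemidef_fderiv_xiPrime hβ hQ] with q hTP hP hA hmem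
  have hS : (∫ t in Icc q τ, defect β h x Φ t ∂μ).IsHermitian := by
    simpa only [neg_neg] using (hneg hmem.1.le).isHermitian.neg
  have hPT : pathDeriv Φ q * ∫ t in Icc q τ, defect β h x Φ t ∂μ = 0 := by
    simpa only [Matrix.conjTranspose_mul, Matrix.conjTranspose_zero, hS.eq,
      (hP hmem).isHermitian.eq] using congrArg Matrix.conjTranspose (hTP hmem)
  have hhat := hT.posDef_pathHat (Ioo_subset_Icc_self hmem)
  have hpair := frob_nonneg (hneg hmem.1.le)
    (posSemidef_mul_mul_same hhat.isHermitian (hA hmem))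
  rw [← frobCLM_apply, map_neg, neg_apply, frobCLM_apply, frob_eq_trace, hS.eq,
    ← trace_mul_deriv_conj hhat.isUnit (hTP hmem) hPT (x q)] at hpair
  rwa [Pi.zero_apply, frobCLM_apply, frob_eq_trace, hS.eq]

lemma ae_defect_eq_zero : ∀ᵐ t ∂μ, t ∈ Icc 0 τ → defect β h x Φ t = 0 := by
  have := hμ.isProbabilityMeasure hT.distr.right_end
  have hF := hT.isLipschitzPrimitiveOn_defect hβ hQ (h := h)
  have hH := (hT.isLipschitzPrimitiveOn_pathHat.mul hF).mul hT.isLipschitzPrimitiveOn_pathHat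
  have hnonneg : ∀ᵐ t ∂μ.restrict (Icc 0 τ), 0 ≤ frobCLM (defect β h x Φ t)
      (pathHat x Φ t * defect β h x Φ t * pathHat x Φ t) := by
    refine (ae_restrict_iff' measurableSet_Icc).2 (ae_of_all _ fun t ht => ?_)
    have hherm := hT.isHermitian_defect ht (β := β) (h := h)
    rw [frobCLM_apply, frob_eq_trace, hherm.eq]
    exact trace_mul_conj_nonneg hherm (hT.posDef_pathHat ht).posSemidef
  have hzero := (integral_eq_zero_iff_of_nonneg_ae hnonneg
    (hF.bilinear frobCLM hH).continuousOn.integrableOn_Icc).1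
    ((hmin.setIntegral_frob_defect_conj_nonpos hβ hQ hT hμ).antisymm
      (integral_nonneg_of_ae hnonneg))
  filter_upwards [(ae_restrict_iff' measurableSet_Icc).1 hzero] with t ht hmem
  have hherm := hT.isHermitian_defect hmem (β := β) (h := h)
  refine eq_zero_of_trace_mul_conj_eq_zero hherm (hT.posDef_pathHat hmem) ?_
  have hpair := ht hmem
  rwa [frobCLM_apply, frob_eq_trace, hherm.eq] at hpair

lemma defect_eq_zero {t : ℝ} (ht : t ∈ Ico 0 τ) (hsupp : t ∈ μ.support) :
    defect β h x Φ t = 0 := by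
  by_contra hne
  have hnear : ∀ᶠ s in 𝓝 t, s ∈ Icc 0 τ → defect β h x Φ s ≠ 0 :=
    eventually_nhdsWithin_iff.1 <| ((hT.isLipschitzPrimitiveOn_defect hβ hQ).continuousOn t
      (Ico_subset_Icc_self ht)).eventually (isOpen_ne.mem_nhds hne)
  have hnull : μ {s | (s ∈ Icc 0 τ → defect β h x Φ s ≠ 0) ∧ s < τ} = 0 := by
    have hnonneg : ∀ᵐ s ∂μ, s ∈ Icc (0 : ℝ) m := hμ.1
    rw [measure_eq_zero_iff_ae_notMem]
    filter_upwards [hmin.ae_defect_eq_zero hβ hQ hT hμ, hnonneg] with s hs hsm hbad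
    have hsτ : s ∈ Icc 0 τ := ⟨hsm.1, hbad.2.le⟩
    exact hbad.1 hsτ (hs hsτ)
  exact ((Measure.mem_support_iff_forall t).1 hsupp _
    (hnear.and (eventually_lt_nhds ht.2))).ne' hnull

end IsMinimizer

end Minimizer

lemma IsParisiMeasure.mem_Ico_of_mem_support (hμ : IsParisiMeasure m x μ)
    (hT : IsTruncated Q x Φ τ) {t : ℝ} (ht : t ∈ μ.support) : t ∈ Ico 0 τ := by
  have := hμ.isProbabilityMeasure hT.distr.right_end
  obtain ⟨s, hs, hsτ⟩ := exists_between hT.cutoff.1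
  have hsm : s ∈ Icc (0 : ℝ) m := ⟨topTime_nonneg.trans hs.le, hsτ.le.trans hT.lt.le⟩
  have hae : Icc 0 s ∈ ae μ := by
    rw [mem_ae_iff, prob_compl_eq_zero_iff measurableSet_Icc, hμ.2 s hsm,
      hT.distr.eq_one_of_topTime_lt hs hsm.2, ENNReal.ofReal_one]
  have hmem := Measure.support_subset_of_isClosed isClosed_Icc hae ht
  exact ⟨hmem.1, hmem.2.trans_lt hsτ⟩

end Rigidity

end VectorSpin

end

theorem mainTheorem5_general {m : ℕ} {β : ℕ → Fin m → ℝ}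
    (hβ : ∀ j, Summable fun p : ℕ => (2 : ℝ) ^ p * β p j ^ 2) {h : Fin m → ℝ}
    {Q : Matrix (Fin m) (Fin m) ℝ} (hQ : ∀ i, Q i i = 1) {x : ℝ → ℝ}
    {Φ : ℝ → Matrix (Fin m) (Fin m) ℝ} (hmin : VectorSpin.IsMinimizer β h Q x Φ)
    {μ : Measure ℝ} (hμ : VectorSpin.IsParisiMeasure m x μ) {t : ℝ} (ht : t ∈ μ.support) :
    (∀ s ∈ Icc 0 t, IsUnit (VectorSpin.pathHat x Φ s).det) ∧
    ∀ i j : Fin m,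
      IntervalIntegrable (fun s => ((VectorSpin.pathHat x Φ s)⁻¹ * VectorSpin.pathDeriv Φ s *
        (VectorSpin.pathHat x Φ s)⁻¹) i j) volume 0 t ∧
      (VectorSpin.xiPrime β (Φ t) + Matrix.vecMulVec h h) i j =
        ∫ s in (0 : ℝ)..t, ((VectorSpin.pathHat x Φ s)⁻¹ * VectorSpin.pathDeriv Φ s *
          (VectorSpin.pathHat x Φ s)⁻¹) i j := by
  obtain ⟨τ, hτ⟩ := hmin.1.exists_isCutoff
  have hT : VectorSpin.IsTruncated Q x Φ τ := ⟨hmin.1, hτ⟩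
  have htτ : t ∈ Ico 0 τ := hμ.mem_Ico_of_mem_support hT ht
  have hint := (hT.isLipschitzPrimitiveOn_conjIntegral.mono le_rfl htτ.2.le).intervalIntegrable
    htτ.1
  refine ⟨fun s hs => (hT.posDef_pathHat ⟨hs.1, hs.2.trans htτ.2.le⟩).det_pos.ne'.isUnit,
    fun i j => ?_⟩
  let entry := (Matrix.entryLinearMap ℝ ℝ i j).toContinuousLinearMap
  refine ⟨⟨entry.integrable_comp hint.1, entry.integrable_comp hint.2⟩, ?_⟩
  rw [sub_eq_zero.1 (hmin.defect_eq_zero hβ hQ hT hμ htτ ht)]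
  exact (entry.intervalIntegral_comp_comm hint).symm

theorem mainTheorem5 (m : ℕ) (hm : 1 ≤ m)
    (β : ℕ → Fin m → ℝ)
    (hβ_even : ∀ p : ℕ, 3 ≤ p → Odd p → ∀ j, β p j = 0)
    (hβ_sum : ∀ j, Summable fun p : ℕ => (2 : ℝ) ^ p * β p j ^ 2)
    (h : Fin m → ℝ)
    (Q : Matrix (Fin m) (Fin m) ℝ) (hQ : VectorSpin.IsOverlapConstraint Q)
    (x : ℝ → ℝ) (Φ : ℝ → Matrix (Fin m) (Fin m) ℝ)
    (hmin : VectorSpin.IsMinimizer β h Q x Φ)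
    (μ : MeasureTheory.Measure ℝ) (hμ : VectorSpin.IsParisiMeasure m x μ)
    (t : ℝ) (ht : t ∈ μ.support) :
    (∀ s ∈ Set.Icc 0 t, IsUnit (VectorSpin.pathHat x Φ s).det) ∧
    ∀ i j : Fin m,
      IntervalIntegrable (fun s => ((VectorSpin.pathHat x Φ s)⁻¹ * VectorSpin.pathDeriv Φ s *
        (VectorSpin.pathHat x Φ s)⁻¹) i j) MeasureTheory.volume 0 t ∧
      (VectorSpin.xiPrime β (Φ t) + Matrix.vecMulVec h h) i j =
        ∫ s in (0 : ℝ)..t, ((VectorSpin.pathHat x Φ s)⁻¹ * VectorSpin.pathDeriv Φ s *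
          (VectorSpin.pathHat x Φ s)⁻¹) i j :=
  mainTheorem5_general hβ_sum hQ.diag hmin hμ ht
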